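/- Let $\mathfrak g$ be a finite-dimensional complex semisimple Lie algebra with root system $\Phi$ (with respect to a fixed Cartan subalgebra), let $\Pi$ be a basis of $\Phi$, and let $(\cdot,\cdot)$ be the invariant scalar product for which $(\alpha,\alpha)=2$ for all short roots $\alpha$ in each irreducible component of $\Phi$. Let $k$ be a field and let $q\in k$ with $q\neq 0$ and $q^n\neq 1$ for all integers $n\geq 1$. Put $q_\alpha=q^{(\alpha,\alpha)/2}$ and $a_{\alpha\beta}=2(\alpha,\beta)/(\alpha,\alpha)$ for $\alpha,\beta\in\Pi$. Let $U=U_q(\mathfrak g)$ be the unital associative $k$-algebra with generators $E_\alpha,F_\alpha,K_\alpha,K_\alpha^{-1}$ ($\alpha\in\Pi$) and relations $$K_\alpha K_\alpha^{-1}=1=K_\alpha^{-1}K_\alpha,\quad K_\alpha K_\beta=K_\beta K_\alpha,\quad K_\alpha E_\beta K_\alpha^{-1}=q^{(\alpha,\beta)}E_\beta,\quad K_\alpha F_\beta K_\alpha^{-1}=q^{-(\alpha,\beta)}F_\beta,$$ $$E_\alpha F_\beta-F_\beta E_\alpha=\delta_{\alpha\beta}\frac{K_\alpha-K_\alpha^{-1}}{q_\alpha-q_\alpha^{-1}}$$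 for $\alpha,\beta\in\Pi$ and, for $\alpha\neq\beta$, the quantum Serre relations $$\sum_{s=0}^{1-a_{\alpha\beta}}(-1)^s\begin{bmatrix}1-a_{\alpha\beta}\\ s\end{bmatrix}_{q_\alpha}E_\alpha^{1-a_{\alpha\beta}-s}E_\beta E_\alpha^s=0,\qquad \sum_{s=0}^{1-a_{\alpha\beta}}(-1)^s\begin{bmatrix}1-a_{\alpha\beta}\\ s\end{bmatrix}_{q_\alpha}F_\alpha^{1-a_{\alpha\beta}-s}F_\beta F_\alpha^s=0,$$ where $\begin{bmatrix}n\\ s\end{bmatrix}_{v}=\prod_{j=0}^{s-1}\frac{v^{n-j}-v^{-(n-j)}}{v^{j+1}-v^{-(j+1)}}$. Let $\Delta$ be the coproduct of $U$, that is, the algebra homomorphism $\Delta\colon U\to U\otimes U$ with $$\Delta(E_\alpha)=E_\alpha\otimes 1+K_\alpha\otimes E_\alpha,\qquad \Delta(F_\alpha)=F_\alpha\otimes K_\alpha^{-1}+1\otimes F_\alpha,\qquad \Delta(K_\alpha)=K_\alpha\otimes K_\alpha .$$ Let $U^+$, $U^-$ and $U^0$ be the subalgebras of $U$ generated by all $E_\alpha$,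 by all $F_\alpha$, and by all $K_\alpha,K_\alpha^{-1}$, respectively. Let $C$ be a homogeneous right coideal subalgebra of $U$, that is, a unital subalgebra $C\subseteq U$ with $\Delta(C)\subseteq C\otimes U$ and $U^0\subseteq C$. Then the multiplication map $$(U^-\cap C)\otimes U^0\otimes (U^+\cap C)\longrightarrow C,\qquad x\otimes y\otimes z\longmapsto xyz,$$ is an isomorphism of vector spaces. -/

import Mathlib

open scoped TensorProduct
noncomputable section
namespace QuantizedEnveloping

section QBinom
variable {k : Type*} [Field k]

/-- The Gaussian binomial coefficient, symmetric normalization, evaluated at `v`: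
`[n, s] = ∏_{j < s} [n - j] / [j + 1]` with `[m] = (v ^ m - v ^ (-m)) / (v - v⁻¹)`, see
`qBinom_eq_prod`. It is defined through the `q`-Pascal rule, so that it makes sense for every `v`. -/
def qBinom (v : kˣ) : ℕ → ℕ → k
  | _, 0 => 1
  | 0, _ + 1 => 0
  | n + 1, s + 1 =>
      (v : k) ^ (-((s : ℤ) + 1)) * qBinom v n (s + 1) + (v : k) ^ ((n : ℤ) - s) * qBinom v n s

theorem qBinom_zero_right (v : kˣ) (n : ℕ) : qBinom v n 0 = 1 := by
  cases n <;> simp [qBinom]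

theorem qBinom_eq_zero (v : kˣ) (n : ℕ) : ∀ s, n < s → qBinom v n s = 0 := by
  induction n with
  | zero => intro s hs; obtain ⟨t, rfl⟩ := Nat.exists_eq_succ_of_ne_zero (by lia : s ≠ 0); simp [qBinom]
  | succ n ih =>
    intro s hs
    obtain ⟨t, rfl⟩ := Nat.exists_eq_succ_of_ne_zero (by lia : s ≠ 0)
    simp [qBinom, ih (t + 1) (by lia), ih t (by lia)]

theorem qBinom_absorb (v : kˣ) (n : ℕ) : ∀ s : ℕ,
    ((v : k) ^ ((s : ℤ) + 1) - (v : k) ^ (-((s : ℤ) + 1))) * qBinom v n (s + 1)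
      = ((v : k) ^ ((n : ℤ) - s) - (v : k) ^ (-((n : ℤ) - s))) * qBinom v n s := by
  have hv : (v : k) ≠ 0 := v.ne_zero
  induction n with
  | zero =>
    intro s
    cases s <;> simp [qBinom]
  | succ n ih =>
    have key : ∀ s : ℕ, (v : k) ^ (-((s : ℤ) + 1)) * ((v : k) ^ ((n : ℤ) - s) - (v : k) ^ (-((n : ℤ) - s)))
        + (v : k) ^ ((n : ℤ) - s) * ((v : k) ^ ((s : ℤ) + 1) - (v : k) ^ (-((s : ℤ) + 1)))
        = (v : k) ^ ((n : ℤ) + 1) - (v : k) ^ (-((n : ℤ) + 1)) := by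
      intro s
      simp only [mul_sub, ← zpow_add₀ hv]
      ring_nf
    have h1 : ∀ s : ℕ, ((v : k) ^ ((s : ℤ) + 1) - (v : k) ^ (-((s : ℤ) + 1))) * qBinom v (n + 1) (s + 1)
        = ((v : k) ^ ((n : ℤ) + 1) - (v : k) ^ (-((n : ℤ) + 1))) * qBinom v n s := by
      intro s
      rw [qBinom, ← key s]
      linear_combination (v : k) ^ (-((s : ℤ) + 1)) * ih s
    intro s
    rw [h1 s]
    cases s with
    | zero => simp [qBinom_zero_right]
    | succ t =>
      rw [qBinom, ← key t]
      push_cast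
      rw [show (n : ℤ) + 1 - (t + 1) = n - t by ring]
      linear_combination (v : k) ^ ((n : ℤ) - t) * ih t

theorem qBinom_succ_succ (v : kˣ) (n s : ℕ) : qBinom v (n + 1) (s + 1) =
    (v : k) ^ ((s : ℤ) + 1) * qBinom v n (s + 1) + (v : k) ^ (-((n : ℤ) - s)) * qBinom v n s := by
  rw [qBinom]
  linear_combination -qBinom_absorb v n s

/-- If `v` is not a root of unity, `qBinom v n s` is the usual quotient of products of
`q`-integers (the common factors `v - v⁻¹` are cancelled). -/
theorem qBinom_eq_prod (v : kˣ) (hv : ∀ n : ℕ, 0 < n → (v : k) ^ n ≠ 1) (n s : ℕ) :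
    qBinom v n s = ∏ j ∈ Finset.range s,
      ((v : k) ^ ((n : ℤ) - j) - (v : k) ^ (-((n : ℤ) - j))) /
        ((v : k) ^ ((j : ℤ) + 1) - (v : k) ^ (-((j : ℤ) + 1))) := by
  induction s with
  | zero => simp [qBinom_zero_right]
  | succ s ih =>
    have hne : (v : k) ^ ((s : ℤ) + 1) - (v : k) ^ (-((s : ℤ) + 1)) ≠ 0 := by
      intro h
      apply hv (2 * (s + 1)) (by lia)
      have h2 : (v : k) ^ ((s : ℤ) + 1) * (v : k) ^ (-((s : ℤ) + 1)) = 1 := by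
        rw [← zpow_add₀ v.ne_zero]; simp
      rw [← sub_eq_zero.mp h] at h2
      rw [two_mul, pow_add]
      exact_mod_cast h2
    rw [Finset.prod_range_succ, ← ih, ← mul_div_assoc, eq_div_iff hne]
    linear_combination qBinom_absorb v n s

end QBinom

section Serre
variable {k : Type*} [Field k] {R : Type*} [Ring R] [Algebra k R]

/-- The left hand side `∑ₛ (-1)ˢ [n, s]_v xⁿ⁻ˢ y xˢ` of the quantum Serre relation. -/
def serreElement (v : kˣ) (n : ℕ) (x y : R) : R :=
  ∑ s ∈ Finset.range (n + 1), ((-1) ^ s * qBinom v n s) • (x ^ (n - s) * y * x ^ s)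

/-- Iterated `q`-commutators of `y` with `x` (auxiliary, to show that the coproduct respects the
quantum Serre relations). -/
def qAd (v : kˣ) (a : ℤ) (x y : R) : ℕ → R
  | 0 => y
  | m + 1 => x * qAd v a x y m - (v : k) ^ (a + 2 * m) • (qAd v a x y m * x)

theorem qAd_eq_sum (v : kˣ) (a : ℤ) (x y : R) (m : ℕ) :
    qAd v a x y m = ∑ s ∈ Finset.range (m + 1),
      ((-1) ^ s * (v : k) ^ ((s : ℤ) * (a + m - 1)) * qBinom v m s) • (x ^ (m - s) * y * x ^ s) := by
  have hv : (v : k) ≠ 0 := v.ne_zero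
  induction m with
  | zero => simp [qAd, qBinom]
  | succ m ih =>
    rw [qAd, ih, Finset.mul_sum, Finset.sum_mul, Finset.smul_sum, Finset.sum_range_succ' _ (m + 1)]
    have e1 : ∑ s ∈ Finset.range (m + 1), x * (((-1) ^ s * (v : k) ^ ((s : ℤ) * (a + m - 1)) * qBinom v m s)
          • (x ^ (m - s) * y * x ^ s))
        = ∑ s ∈ Finset.range (m + 2), ((-1) ^ s * (v : k) ^ ((s : ℤ) * (a + m - 1)) * qBinom v m s)
          • (x ^ (m + 1 - s) * y * x ^ s) := by
      rw [Finset.sum_range_succ _ (m + 1), qBinom_eq_zero v m (m + 1) (by lia)]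
      simp only [mul_zero, zero_smul, add_zero]
      refine Finset.sum_congr rfl fun s hs => ?_
      rw [Finset.mem_range] at hs
      rw [mul_smul_comm, show m + 1 - s = (m - s) + 1 by lia, pow_succ' x (m - s)]
      simp only [mul_assoc]
    rw [e1, Finset.sum_range_succ' _ (m + 1)]
    simp only [Nat.add_sub_add_right, smul_mul_assoc, mul_assoc, ← pow_succ]
    rw [add_sub_right_comm, ← Finset.sum_sub_distrib]
    congr 1
    · refine Finset.sum_congr rfl fun s _ => ?_
      rw [smul_smul, ← sub_smul]
      congr 1
      rw [qBinom]
      have h1 : (v : k) ^ (((s + 1 : ℕ) : ℤ) * (a + (m + 1 : ℕ) - 1))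
          = (v : k) ^ (((s + 1 : ℕ) : ℤ) * (a + m - 1)) * (v : k) ^ ((s : ℤ) + 1) := by
        rw [← zpow_add₀ hv]; congr 1; push_cast; ring
      have h2 : (v : k) ^ (((s + 1 : ℕ) : ℤ) * (a + (m + 1 : ℕ) - 1)) * (v : k) ^ ((m : ℤ) - s)
          = (v : k) ^ (a + 2 * m) * (v : k) ^ ((s : ℤ) * (a + m - 1)) := by
        rw [← zpow_add₀ hv, ← zpow_add₀ hv]; congr 1; push_cast; ring
      have h3 : (v : k) ^ ((s : ℤ) + 1) * (v : k) ^ (-((s : ℤ) + 1)) = 1 := by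
        rw [← zpow_add₀ hv]; simp
      rw [pow_succ (-1 : k) s]
      linear_combination (-(-1) ^ s) * (-qBinom v m s * h2
        - (v : k) ^ (-((s : ℤ) + 1)) * qBinom v m (s + 1) * h1
        - (v : k) ^ (((s + 1 : ℕ) : ℤ) * (a + m - 1)) * qBinom v m (s + 1) * h3)
    · simp [qBinom_zero_right]

theorem qAd_eq_serreElement (v : kˣ) (n : ℕ) (x y : R) :
    qAd v (1 - n) x y n = serreElement v n x y := by
  rw [qAd_eq_sum, serreElement]
  simp

/-- Coefficients in the coproduct of an iterated `q`-commutator (auxiliary). -/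
def qAdCoeff (v : kˣ) (a : ℤ) (m i : ℕ) : k :=
  (v : k) ^ ((i : ℤ) * (m - i)) * qBinom v m i * ∏ s ∈ Finset.Ico i m, (1 - (v : k) ^ (2 * (a + s)))

theorem qAdCoeff_zero_right (v : kˣ) (a : ℤ) (m : ℕ) :
    qAdCoeff v a (m + 1) 0 = (1 - (v : k) ^ (2 * (a + m))) * qAdCoeff v a m 0 := by
  simp [qAdCoeff, qBinom_zero_right, Finset.prod_range_succ, mul_comm]

theorem qAdCoeff_eq_zero (v : kˣ) (a : ℤ) (m i : ℕ) (h : m < i) : qAdCoeff v a m i = 0 := by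
  simp [qAdCoeff, qBinom_eq_zero v m i h]

theorem qAdCoeff_self (v : kˣ) (a : ℤ) (m : ℕ) : qAdCoeff v a m m = 1 := by
  have : qBinom v m m = 1 := by
    induction m with
    | zero => simp [qBinom]
    | succ m ih => simp [qBinom, ih, qBinom_eq_zero]
  simp [qAdCoeff, this]

theorem qAdCoeff_succ_succ (v : kˣ) (a : ℤ) (m i : ℕ) :
    qAdCoeff v a (m + 1) (i + 1) = (1 - (v : k) ^ (2 * (a + m + (i + 1)))) * qAdCoeff v a m (i + 1)
      + (v : k) ^ (2 * ((m : ℤ) - i)) * qAdCoeff v a m i := by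
  have hv : (v : k) ≠ 0 := v.ne_zero
  rcases lt_trichotomy m i with h | rfl | h
  · simp [qAdCoeff_eq_zero, h, show m < i + 1 by lia]
  · simp [qAdCoeff_eq_zero, qAdCoeff_self]
  · simp only [qAdCoeff]
    rw [Finset.prod_Ico_succ_top (by lia : i + 1 ≤ m), Finset.prod_eq_prod_Ico_succ_bot h]
    generalize ∏ s ∈ Finset.Ico (i + 1) m, (1 - (v : k) ^ (2 * (a + s))) = p
    have A := qBinom_succ_succ v m i
    have B : qBinom v (m + 1) (i + 1) = (v : k) ^ (-((i : ℤ) + 1)) * qBinom v m (i + 1)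
        + (v : k) ^ ((m : ℤ) - i) * qBinom v m i := by rw [qBinom]
    have c1 : (v : k) ^ (((i + 1 : ℕ) : ℤ) * ((m + 1 : ℕ) - (i + 1 : ℕ))) * (v : k) ^ (-((i : ℤ) + 1))
        = (v : k) ^ (((i + 1 : ℕ) : ℤ) * (m - (i + 1 : ℕ))) := by
      rw [← zpow_add₀ hv]; congr 1; push_cast; ring
    have c2 : (v : k) ^ (((i + 1 : ℕ) : ℤ) * ((m + 1 : ℕ) - (i + 1 : ℕ))) * (v : k) ^ ((m : ℤ) - i)
        = (v : k) ^ (2 * ((m : ℤ) - i)) * (v : k) ^ ((i : ℤ) * (m - i)) := by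
      rw [← zpow_add₀ hv, ← zpow_add₀ hv]; congr 1; push_cast; ring
    have c3 : (v : k) ^ (((i + 1 : ℕ) : ℤ) * ((m + 1 : ℕ) - (i + 1 : ℕ))) * (v : k) ^ (2 * (a + m))
          * (v : k) ^ ((i : ℤ) + 1)
        = (v : k) ^ (2 * (a + m + (i + 1))) * (v : k) ^ (((i + 1 : ℕ) : ℤ) * (m - (i + 1 : ℕ))) := by
      rw [← zpow_add₀ hv, ← zpow_add₀ hv, ← zpow_add₀ hv]; congr 1; push_cast; ring
    have c4 : (v : k) ^ (((i + 1 : ℕ) : ℤ) * ((m + 1 : ℕ) - (i + 1 : ℕ))) * (v : k) ^ (2 * (a + m))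
          * (v : k) ^ (-((m : ℤ) - i))
        = (v : k) ^ (2 * ((m : ℤ) - i)) * (v : k) ^ ((i : ℤ) * (m - i)) * (v : k) ^ (2 * (a + i)) := by
      rw [← zpow_add₀ hv, ← zpow_add₀ hv, ← zpow_add₀ hv, ← zpow_add₀ hv]; congr 1; push_cast; ring
    generalize (v : k) ^ (((i + 1 : ℕ) : ℤ) * ((m + 1 : ℕ) - (i + 1 : ℕ))) = V at *
    linear_combination p * V * B - p * V * (v : k) ^ (2 * (a + m)) * A
      + p * qBinom v m (i + 1) * (c1 - c3) + p * qBinom v m i * (c2 - c4)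

theorem qAdCoeff_vanish (v : kˣ) (n i : ℕ) (h : i < n) : qAdCoeff v (1 - n) n i = 0 := by
  rw [qAdCoeff]
  refine mul_eq_zero_of_right _ (Finset.prod_eq_zero (i := n - 1) (by simp; lia) ?_)
  rw [show (1 - (n : ℤ) + ((n - 1 : ℕ) : ℤ)) = 0 by lia]
  simp

variable {x y g h : R}

theorem qAd_pow_comm (v : kˣ) (hgx : g * x = (v : k) ^ (2 : ℤ) • (x * g)) (m : ℕ) :
    g * x ^ m = (v : k) ^ (2 * (m : ℤ)) • (x ^ m * g) := by
  induction m with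
  | zero => simp
  | succ m ih =>
    rw [pow_succ, ← mul_assoc, ih, smul_mul_assoc, mul_assoc, hgx, mul_smul_comm, smul_smul,
      ← zpow_add₀ v.ne_zero, mul_assoc]
    congr 2

theorem pow_comm_qAd (v : kˣ) (hgx : g * x = (v : k) ^ (2 : ℤ) • (x * g)) (m : ℕ) :
    g ^ m * x = (v : k) ^ (2 * (m : ℤ)) • (x * g ^ m) := by
  induction m with
  | zero => simp
  | succ m ih =>
    rw [pow_succ, mul_assoc, hgx, mul_smul_comm, ← mul_assoc, ih, smul_mul_assoc, smul_smul,
      ← zpow_add₀ v.ne_zero, mul_assoc]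
    congr 2; push_cast; ring

theorem comm_qAd (v : kˣ) (a : ℤ) (hgx : g * x = (v : k) ^ (2 : ℤ) • (x * g))
    (hgy : g * y = (v : k) ^ a • (y * g)) (m : ℕ) :
    g * qAd v a x y m = (v : k) ^ (a + 2 * m) • (qAd v a x y m * g) := by
  induction m with
  | zero => simpa [qAd] using hgy
  | succ m ih =>
    have hv : (v : k) ≠ 0 := v.ne_zero
    generalize hu : qAd v a x y m = u at ih
    have e1 : g * (x * u) = (v : k) ^ (a + 2 * ((m + 1 : ℕ) : ℤ)) • (x * u * g) := by
      rw [← mul_assoc, hgx, smul_mul_assoc, mul_assoc, ih, mul_smul_comm, smul_smul,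
        ← zpow_add₀ hv, mul_assoc]
      congr 2; push_cast; ring
    have e2 : g * (u * x) = (v : k) ^ (a + 2 * ((m + 1 : ℕ) : ℤ)) • (u * x * g) := by
      rw [← mul_assoc, ih, smul_mul_assoc, mul_assoc, hgx, mul_smul_comm, smul_smul,
        ← zpow_add₀ hv, mul_assoc]
      congr 2; push_cast; ring
    rw [qAd, hu, mul_sub, mul_smul_comm, e1, e2, sub_mul, smul_mul_assoc, smul_sub,
      smul_comm ((v : k) ^ (a + 2 * (m : ℤ)))]

theorem qAd_tmul (v : kˣ) (a : ℤ) (hgx : g * x = (v : k) ^ (2 : ℤ) • (x * g))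
    (hgy : g * y = (v : k) ^ a • (y * g)) (hhx : h * x = (v : k) ^ a • (x * h))
    (hhg : h * g = g * h) (m : ℕ) :
    qAd v a (x ⊗ₜ[k] (1 : R) + g ⊗ₜ[k] x) (y ⊗ₜ[k] (1 : R) + h ⊗ₜ[k] y) m
      = qAd v a x y m ⊗ₜ[k] (1 : R) + ∑ i ∈ Finset.range (m + 1),
        qAdCoeff v a m i • ((x ^ (m - i) * g ^ i * h) ⊗ₜ[k] qAd v a x y i) := by
  have hv : (v : k) ≠ 0 := v.ne_zero
  induction m with
  | zero => simp [qAd, qAdCoeff, qBinom]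
  | succ m ih =>
    rw [qAd, ih]
    have step : ∀ i ∈ Finset.range (m + 1),
        (x ⊗ₜ[k] (1 : R) + g ⊗ₜ[k] x) *
            (qAdCoeff v a m i • ((x ^ (m - i) * g ^ i * h) ⊗ₜ[k] qAd v a x y i))
          - (v : k) ^ (a + 2 * m) •
            ((qAdCoeff v a m i • ((x ^ (m - i) * g ^ i * h) ⊗ₜ[k] qAd v a x y i)) *
            (x ⊗ₜ[k] (1 : R) + g ⊗ₜ[k] x))
          = ((1 - (v : k) ^ (2 * (a + m + i))) * qAdCoeff v a m i) •
              ((x ^ (m + 1 - i) * g ^ i * h) ⊗ₜ[k] qAd v a x y i)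
            + ((v : k) ^ (2 * ((m : ℤ) - i)) * qAdCoeff v a m i) •
              ((x ^ (m - i) * g ^ (i + 1) * h) ⊗ₜ[k] qAd v a x y (i + 1)) := by
      intro i hi
      rw [Finset.mem_range] at hi
      generalize hu : qAd v a x y i = u
      have p1 : x * (x ^ (m - i) * g ^ i * h) = x ^ (m + 1 - i) * g ^ i * h := by
        rw [show m + 1 - i = (m - i) + 1 by lia, pow_succ' x (m - i)]
        simp only [mul_assoc]
      have p2 : x ^ (m - i) * g ^ i * h * x
          = (v : k) ^ (a + 2 * i) • (x ^ (m + 1 - i) * g ^ i * h) := by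
        rw [mul_assoc, hhx, mul_smul_comm, ← mul_assoc, mul_assoc (x ^ (m - i)),
          pow_comm_qAd v hgx, mul_smul_comm, smul_mul_assoc, smul_smul, ← zpow_add₀ hv,
          ← mul_assoc, ← pow_succ, show m + 1 - i = (m - i) + 1 by lia]
      have p3 : g * (x ^ (m - i) * g ^ i * h)
          = (v : k) ^ (2 * ((m : ℤ) - i)) • (x ^ (m - i) * g ^ (i + 1) * h) := by
        rw [← mul_assoc, ← mul_assoc, qAd_pow_comm v hgx, smul_mul_assoc, smul_mul_assoc,
          mul_assoc (x ^ (m - i)), ← pow_succ', show ((m - i : ℕ) : ℤ) = (m : ℤ) - i by lia]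
      have p4 : x ^ (m - i) * g ^ i * h * g = x ^ (m - i) * g ^ (i + 1) * h := by
        rw [mul_assoc, hhg, ← mul_assoc, mul_assoc (x ^ (m - i)), ← pow_succ]
      have z1 : (v : k) ^ (a + 2 * (m : ℤ)) * (v : k) ^ (a + 2 * (i : ℤ))
          = (v : k) ^ (2 * (a + m + i)) := by
        rw [← zpow_add₀ hv]; congr 1; ring
      have z2 : (v : k) ^ (a + 2 * (m : ℤ))
          = (v : k) ^ (2 * ((m : ℤ) - i)) * (v : k) ^ (a + 2 * (i : ℤ)) := by
        rw [← zpow_add₀ hv]; congr 1; ring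
      rw [qAd, hu, ← z1]
      simp only [add_mul, mul_add, mul_smul_comm, smul_mul_assoc,
        Algebra.TensorProduct.tmul_mul_tmul, p1, p2, p3, p4, one_mul, mul_one,
        TensorProduct.tmul_sub, TensorProduct.tmul_smul, ← TensorProduct.smul_tmul']
      generalize (x ^ (m + 1 - i) * g ^ i * h) ⊗ₜ[k] u = t1
      generalize (x ^ (m - i) * g ^ (i + 1) * h) ⊗ₜ[k] (x * u) = t2
      generalize (x ^ (m - i) * g ^ (i + 1) * h) ⊗ₜ[k] (u * x) = t3
      rw [z2]
      module
    have base : (x ⊗ₜ[k] (1 : R) + g ⊗ₜ[k] x) * (qAd v a x y m ⊗ₜ[k] (1 : R))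
          - (v : k) ^ (a + 2 * m) •
            ((qAd v a x y m ⊗ₜ[k] (1 : R)) * (x ⊗ₜ[k] (1 : R) + g ⊗ₜ[k] x))
        = qAd v a x y (m + 1) ⊗ₜ[k] (1 : R) := by
      rw [qAd]
      simp only [add_mul, mul_add, Algebra.TensorProduct.tmul_mul_tmul, one_mul, mul_one,
        comm_qAd v a hgx hgy, TensorProduct.sub_tmul, ← TensorProduct.smul_tmul']
      module
    generalize x ⊗ₜ[k] (1 : R) + g ⊗ₜ[k] x = X at base step ⊢
    rw [mul_add, add_mul, smul_add, add_sub_add_comm, base, Finset.mul_sum, Finset.sum_mul,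
      Finset.smul_sum, ← Finset.sum_sub_distrib, Finset.sum_congr rfl step,
      Finset.sum_add_distrib, add_right_inj, Finset.sum_range_succ' _ (m + 1)]
    simp only [qAdCoeff_succ_succ, add_smul, Finset.sum_add_distrib, Nat.add_sub_add_right,
      qAdCoeff_zero_right]
    rw [add_right_comm, add_left_inj]
    have ext : ∑ i ∈ Finset.range (m + 1), ((1 - (v : k) ^ (2 * (a + m + i))) * qAdCoeff v a m i) •
              ((x ^ (m + 1 - i) * g ^ i * h) ⊗ₜ[k] qAd v a x y i)
        = ∑ i ∈ Finset.range (m + 2), ((1 - (v : k) ^ (2 * (a + m + i))) * qAdCoeff v a m i) •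
              ((x ^ (m + 1 - i) * g ^ i * h) ⊗ₜ[k] qAd v a x y i) := by
      rw [Finset.sum_range_succ _ (m + 1), qAdCoeff_eq_zero v a m (m + 1) (by lia)]
      simp
    rw [ext, Finset.sum_range_succ' _ (m + 1)]
    simp

/-- If `x`, `y` satisfy the quantum Serre relation, then so do `x ⊗ 1 + g ⊗ x` and
`y ⊗ 1 + h ⊗ y`, for `g`, `h` which `q`-commute with `x`, `y` in the appropriate way. -/
theorem serreElement_tmul (v : kˣ) (n : ℕ)
    (hgx : g * x = (v : k) ^ (2 : ℤ) • (x * g))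
    (hgy : g * y = (v : k) ^ (1 - n : ℤ) • (y * g)) (hhx : h * x = (v : k) ^ (1 - n : ℤ) • (x * h))
    (hhg : h * g = g * h)
    (h0 : serreElement v n x y = 0) :
    serreElement v n (x ⊗ₜ[k] (1 : R) + g ⊗ₜ[k] x) (y ⊗ₜ[k] (1 : R) + h ⊗ₜ[k] y) = 0 := by
  rw [← qAd_eq_serreElement] at h0 ⊢
  rw [qAd_tmul v _ hgx hgy hhx hhg, Finset.sum_range_succ, h0, Finset.sum_eq_zero]
  · simp
  · intro i hi
    rw [qAdCoeff_vanish v n i (Finset.mem_range.mp hi), zero_smul]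

end Serre
section Form
variable {ι K M N : Type*} [Fintype ι] [Field K] [CharZero K] [AddCommGroup M] [Module K M]
  [AddCommGroup N] [Module K N] (P : RootPairing ι K M N) [P.IsCrystallographic]

/-- Two roots lie in the same irreducible component of the root system: they are linked by a chain
of roots in which neighbours are not orthogonal. -/
def SameComponent (i j : ι) : Prop :=
  Relation.ReflTransGen (fun a b => P.pairingIn ℤ a b ≠ 0) i j

/-- The squared length (for the canonical invariant form `∑ₖ ⟨x, αₖ^∨⟩ ⟨y, αₖ^∨⟩`) of the short
roots in the irreducible component of the root `i`. -/
def shortLength (i : ι) : ℤ :=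
  ⨅ j : {j : ι // SameComponent P i j}, (P.posRootForm ℤ).rootLength j

/-- The values `(αᵢ, αⱼ)` on roots of the invariant scalar product for which `(α, α) = 2` for all
short roots `α` in each irreducible component. The division is exact, see
`normForm_mul_shortLength`; roots in different components are orthogonal. -/
def normForm (i j : ι) : ℤ :=
  2 * (P.posRootForm ℤ).posForm (P.rootSpanMem ℤ i) (P.rootSpanMem ℤ j) / shortLength P i

variable {P}

theorem pairingIn_ne_zero_symm {i j : ι} (h : P.pairingIn ℤ i j ≠ 0) : P.pairingIn ℤ j i ≠ 0 := by
  have h1 := (P.posRootForm ℤ).pairingIn_mul_eq_pairingIn_mul_swap i j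
  have h2 := (P.posRootForm ℤ).rootLength_pos i
  have h3 := (P.posRootForm ℤ).rootLength_pos j
  intro h0
  rw [h0, zero_mul] at h1
  exact (mul_ne_zero h h3.ne') h1.symm

theorem SameComponent.symm {i j : ι} (h : SameComponent P i j) : SameComponent P j i := by
  have : Std.Symm (fun a b => P.pairingIn ℤ a b ≠ 0) := ⟨fun _ _ => pairingIn_ne_zero_symm⟩
  exact Std.Symm.symm (r := Relation.ReflTransGen (fun a b => P.pairingIn ℤ a b ≠ 0)) _ _ h

theorem shortLength_congr {i j : ι} (h : SameComponent P i j) :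
    shortLength P i = shortLength P j := by
  have : (fun l => SameComponent P i l) = fun l => SameComponent P j l := by
    funext l
    exact propext ⟨fun hl => h.symm.trans hl, fun hl => h.trans hl⟩
  unfold shortLength
  rw [show (SameComponent P i) = SameComponent P j from this]

theorem shortLength_le {i j : ι} (h : SameComponent P i j) :
    shortLength P i ≤ (P.posRootForm ℤ).rootLength j :=
  ciInf_le (f := fun j : {j : ι // SameComponent P i j} => (P.posRootForm ℤ).rootLength j)
    (Set.finite_range _).bddBelow ⟨j, h⟩

theorem exists_shortLength_eq (i : ι) :
    ∃ j, SameComponent P i j ∧ (P.posRootForm ℤ).rootLength j = shortLength P i := by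
  have : Nonempty {j : ι // SameComponent P i j} := ⟨⟨i, .refl⟩⟩
  obtain ⟨j, hj⟩ := exists_eq_ciInf_of_finite
    (f := fun j : {j : ι // SameComponent P i j} => (P.posRootForm ℤ).rootLength j)
  exact ⟨j, j.2, hj⟩

theorem shortLength_pos (i : ι) : 0 < shortLength P i := by
  obtain ⟨j, -, hj⟩ := exists_shortLength_eq (P := P) i
  rw [← hj]
  exact (P.posRootForm ℤ).rootLength_pos j

theorem two_mul_posForm (i j : ι) :
    2 * (P.posRootForm ℤ).posForm (P.rootSpanMem ℤ i) (P.rootSpanMem ℤ j)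
      = P.pairingIn ℤ i j * (P.posRootForm ℤ).rootLength j := by
  apply FaithfulSMul.algebraMap_injective ℤ K
  have := (P.posRootForm ℤ).two_mul_apply_root_root i j
  rw [map_mul, map_mul, RootPairing.RootPositiveForm.algebraMap_posForm,
    RootPairing.RootPositiveForm.algebraMap_rootLength, RootPairing.algebraMap_pairingIn, ← this]
  simp

theorem rootLength_reflectionPerm (i j : ι) :
    (P.posRootForm ℤ).rootLength (P.reflectionPerm i j) = (P.posRootForm ℤ).rootLength j := by
  apply FaithfulSMul.algebraMap_injective ℤ K
  rw [RootPairing.RootPositiveForm.algebraMap_rootLength,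
    RootPairing.RootPositiveForm.algebraMap_rootLength, P.root_reflectionPerm]
  exact (P.posRootForm ℤ).toInvariantForm.apply_reflection_reflection i _ _

theorem exists_short {i j : ι} (h : SameComponent P i j) :
    ∃ l, P.pairingIn ℤ i l ≠ 0 ∧ (P.posRootForm ℤ).rootLength l = (P.posRootForm ℤ).rootLength j := by
  induction h using Relation.ReflTransGen.head_induction_on with
  | refl => exact ⟨j, by simp, rfl⟩
  | @head i a hia _ ih =>
    obtain ⟨l, hl, hlen⟩ := ih
    by_cases hil : P.pairingIn ℤ i l = 0
    · refine ⟨P.reflectionPerm a l, ?_, by rw [rootLength_reflectionPerm, hlen]⟩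
      have e : P.pairingIn ℤ i (P.reflectionPerm a l)
          = P.pairingIn ℤ i l - P.pairingIn ℤ i a * P.pairingIn ℤ a l := by
        rw [RootPairing.pairingIn_reflectionPerm]
        apply FaithfulSMul.algebraMap_injective ℤ K
        simp only [map_sub, map_mul, RootPairing.algebraMap_pairingIn]
        rw [← P.root_coroot'_eq_pairing, P.root_reflectionPerm, P.reflection_apply_root]
        simp
      rw [e, hil, zero_sub, neg_ne_zero]
      exact mul_ne_zero hia hl
    · exact ⟨l, hil, hlen⟩

theorem normForm_symm (i j : ι) : normForm P i j = normForm P j i := by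
  have hs : (P.posRootForm ℤ).posForm (P.rootSpanMem ℤ i) (P.rootSpanMem ℤ j)
      = (P.posRootForm ℤ).posForm (P.rootSpanMem ℤ j) (P.rootSpanMem ℤ i) :=
    (P.posRootForm ℤ).isSymm_posForm.eq _ _
  by_cases h : P.pairingIn ℤ i j = 0
  · have h1 := two_mul_posForm (P := P) i j
    rw [h, zero_mul] at h1
    rw [normForm, normForm, ← hs, h1]
    simp
  · rw [normForm, normForm, hs, shortLength_congr (.single h)]

variable [P.IsReduced]

theorem shortLength_dvd (i : ι) : shortLength P i ∣ (P.posRootForm ℤ).rootLength i := by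
  obtain ⟨j, hij, hj⟩ := exists_shortLength_eq (P := P) i
  obtain ⟨l, hil, hl⟩ := exists_short hij
  have hle := shortLength_le (P := P) (i := i) .refl
  rw [← hj, ← hl] at hle ⊢
  have h1 := (P.posRootForm ℤ).pairingIn_mul_eq_pairingIn_mul_swap i l
  have h2 := (P.posRootForm ℤ).rootLength_pos i
  have h3 := (P.posRootForm ℤ).rootLength_pos l
  generalize (P.posRootForm ℤ).rootLength i = A at *
  generalize (P.posRootForm ℤ).rootLength l = B at *
  have hm := P.pairingIn_pairingIn_mem_set_of_isCrystal_of_isRed i l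
  simp only [Set.mem_insert_iff, Set.mem_singleton_iff, Prod.mk.injEq] at hm
  rcases hm with h | h | h | h | h | h | h | h | h | h | h | h | h <;>
    rw [h.1, h.2] at h1 <;> first | exact absurd h.1 hil | skip
  all_goals first
    | exact ⟨1, by lia⟩
    | exact ⟨2, by lia⟩
    | exact ⟨3, by lia⟩

theorem normForm_mul_shortLength (i j : ι) : normForm P i j * shortLength P i
    = 2 * (P.posRootForm ℤ).posForm (P.rootSpanMem ℤ i) (P.rootSpanMem ℤ j) := by
  refine Int.ediv_mul_cancel ?_
  rw [two_mul_posForm]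
  by_cases h : P.pairingIn ℤ i j = 0
  · simp [h]
  · rw [shortLength_congr (.single h)]
    exact (shortLength_dvd j).mul_left _

theorem normForm_self_even (i : ι) : 2 * (normForm P i i / 2) = normForm P i i := by
  refine Int.mul_ediv_cancel' ?_
  rw [normForm]
  have h := shortLength_dvd (P := P) i
  obtain ⟨c, hc⟩ := h
  refine ⟨c, ?_⟩
  rw [show (P.posRootForm ℤ).posForm (P.rootSpanMem ℤ i) (P.rootSpanMem ℤ i)
    = (P.posRootForm ℤ).rootLength i from rfl, hc]
  rw [show 2 * (shortLength P i * c) = 2 * c * shortLength P i by ring,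
    Int.mul_ediv_cancel _ (shortLength_pos i).ne']

theorem normForm_eq (i j : ι) : normForm P i j = normForm P i i / 2 * P.pairingIn ℤ j i := by
  have h1 := normForm_mul_shortLength (P := P) i j
  have h2 := normForm_mul_shortLength (P := P) i i
  have h3 := normForm_self_even (P := P) i
  have hs : (P.posRootForm ℤ).posForm (P.rootSpanMem ℤ i) (P.rootSpanMem ℤ j)
      = (P.posRootForm ℤ).posForm (P.rootSpanMem ℤ j) (P.rootSpanMem ℤ i) :=
    (P.posRootForm ℤ).isSymm_posForm.eq _ _
  rw [hs, two_mul_posForm] at h1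
  rw [show (P.posRootForm ℤ).posForm (P.rootSpanMem ℤ i) (P.rootSpanMem ℤ i)
    = (P.posRootForm ℤ).rootLength i from rfl] at h2
  refine mul_right_cancel₀ (mul_ne_zero two_ne_zero (shortLength_pos (P := P) i).ne') ?_
  linear_combination 2 * h1 - P.pairingIn ℤ j i * h2
    - shortLength P i * P.pairingIn ℤ j i * h3

end Form
section Algebra
variable {J L M N : Type*} [Fintype J] [Field L] [CharZero L] [AddCommGroup M] [Module L M]
  [AddCommGroup N] [Module L N] {P : RootPairing J L M N} [P.IsCrystallographic]
  {k : Type*} [Field k]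

/-- The generators `E_α, F_α, K_α, K_α⁻¹` (`α` in the base). -/
inductive Gen (I : Type*) : Type _
  | E (i : I)
  | F (i : I)
  | K (i : I)
  | Kinv (i : I)

/-- `q_α = q ^ ((α, α) / 2)`. -/
def qRoot (q : kˣ) (P : RootPairing J L M N) [P.IsCrystallographic] (i : J) : kˣ :=
  q ^ (normForm P i i / 2)

open FreeAlgebra in
/-- The defining relations of the quantized enveloping algebra. In the Serre relations,
`P.pairingIn ℤ j i = ⟨αⱼ, αᵢ^∨⟩ = 2 (αᵢ, αⱼ) / (αᵢ, αᵢ)`. -/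
inductive Rel (b : P.Base) (q : kˣ) :
    FreeAlgebra k (Gen b.support) → FreeAlgebra k (Gen b.support) → Prop
  | K_mul_Kinv (i : b.support) : Rel b q (ι k (.K i) * ι k (.Kinv i)) 1
  | Kinv_mul_K (i : b.support) : Rel b q (ι k (.Kinv i) * ι k (.K i)) 1
  | K_mul_K (i j : b.support) : Rel b q (ι k (.K i) * ι k (.K j)) (ι k (.K j) * ι k (.K i))
  | K_mul_E (i j : b.support) : Rel b q (ι k (.K i) * ι k (.E j) * ι k (.Kinv i))
      ((q : k) ^ normForm P i j • ι k (.E j))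
  | K_mul_F (i j : b.support) : Rel b q (ι k (.K i) * ι k (.F j) * ι k (.Kinv i))
      ((q : k) ^ (-normForm P i j) • ι k (.F j))
  | E_mul_F_self (i : b.support) :
      Rel b q (ι k (.E i) * ι k (.F i) - ι k (.F i) * ι k (.E i))
        (((qRoot q P i : k) - (qRoot q P i : k)⁻¹)⁻¹ • (ι k (.K i) - ι k (.Kinv i)))
  | E_mul_F_of_ne (i j : b.support) : i ≠ j →
      Rel b q (ι k (.E i) * ι k (.F j) - ι k (.F j) * ι k (.E i)) 0
  | serre_E (i j : b.support) : i ≠ j →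
      Rel b q (serreElement (qRoot q P i) (1 - P.pairingIn ℤ j i).toNat (ι k (.E i)) (ι k (.E j))) 0
  | serre_F (i j : b.support) : i ≠ j →
      Rel b q (serreElement (qRoot q P i) (1 - P.pairingIn ℤ j i).toNat (ι k (.F i)) (ι k (.F j))) 0

/-- The quantized enveloping algebra over `k`, with parameter `q`, attached to a root system with
base `b`. -/
def Uq (b : P.Base) (q : kˣ) : Type _ := RingQuot (Rel b q)

instance (b : P.Base) (q : kˣ) : Ring (Uq b q) := inferInstanceAs (Ring (RingQuot (Rel b q)))

instance (b : P.Base) (q : kˣ) : Algebra k (Uq b q) :=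
  inferInstanceAs (Algebra k (RingQuot (Rel b q)))

namespace Uq

def mk (b : P.Base) (q : kˣ) : FreeAlgebra k (Gen b.support) →ₐ[k] Uq b q :=
  RingQuot.mkAlgHom k (Rel b q)

def E (b : P.Base) (q : kˣ) (i : b.support) : Uq b q := mk b q (FreeAlgebra.ι k (.E i))

def F (b : P.Base) (q : kˣ) (i : b.support) : Uq b q := mk b q (FreeAlgebra.ι k (.F i))

def K (b : P.Base) (q : kˣ) (i : b.support) : Uq b q := mk b q (FreeAlgebra.ι k (.K i))

def Kinv (b : P.Base) (q : kˣ) (i : b.support) : Uq b q := mk b q (FreeAlgebra.ι k (.Kinv i))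

variable (b : P.Base) (q : kˣ)

theorem mk_eq {x y : FreeAlgebra k (Gen b.support)} (h : Rel b q x y) : mk b q x = mk b q y :=
  RingQuot.mkAlgHom_rel k h

theorem map_serreElement {R S : Type*} [Ring R] [Algebra k R] [Ring S] [Algebra k S]
    (f : R →ₐ[k] S) (v : kˣ) (n : ℕ) (x y : R) :
    f (serreElement v n x y) = serreElement v n (f x) (f y) := by
  simp [serreElement]

theorem K_mul_Kinv (i : b.support) : K b q i * Kinv b q i = 1 := by
  simpa [E, F, K, Kinv] using mk_eq b q (.K_mul_Kinv i)

theorem Kinv_mul_K (i : b.support) : Kinv b q i * K b q i = 1 := by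
  simpa [E, F, K, Kinv] using mk_eq b q (.Kinv_mul_K i)

theorem K_mul_K (i j : b.support) : K b q i * K b q j = K b q j * K b q i := by
  simpa [E, F, K, Kinv] using mk_eq b q (.K_mul_K i j)

theorem K_E_Kinv (i j : b.support) :
    K b q i * E b q j * Kinv b q i = (q : k) ^ normForm P i j • E b q j := by
  simpa [E, F, K, Kinv] using mk_eq b q (.K_mul_E i j)

theorem K_F_Kinv (i j : b.support) :
    K b q i * F b q j * Kinv b q i = (q : k) ^ (-normForm P i j) • F b q j := by
  simpa [E, F, K, Kinv] using mk_eq b q (.K_mul_F i j)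

theorem K_mul_E (i j : b.support) :
    K b q i * E b q j = (q : k) ^ normForm P i j • (E b q j * K b q i) := by
  have h := K_E_Kinv b q i j
  rw [← smul_mul_assoc, ← h, mul_assoc _ _ (K b q i), Kinv_mul_K, mul_one]

theorem K_mul_F (i j : b.support) :
    K b q i * F b q j = (q : k) ^ (-normForm P i j) • (F b q j * K b q i) := by
  have h := K_F_Kinv b q i j
  rw [← smul_mul_assoc, ← h, mul_assoc _ _ (K b q i), Kinv_mul_K, mul_one]

theorem Kinv_comm_of {i : b.support} {c : k} (hc : c ≠ 0) {x : Uq b q}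
    (h : K b q i * x = c • (x * K b q i)) : Kinv b q i * x = c⁻¹ • (x * Kinv b q i) := by
  have h1 : Kinv b q i * (K b q i * x) * Kinv b q i = x * Kinv b q i := by
    rw [← mul_assoc, Kinv_mul_K, one_mul]
  rw [← h1, h, mul_smul_comm, smul_mul_assoc, smul_smul, inv_mul_cancel₀ hc, one_smul, mul_assoc,
    mul_assoc x, K_mul_Kinv, mul_one]

theorem Kinv_mul_E (i j : b.support) :
    Kinv b q i * E b q j = (q : k) ^ (-normForm P i j) • (E b q j * Kinv b q i) := by
  rw [zpow_neg]
  exact Kinv_comm_of b q (zpow_ne_zero _ q.ne_zero) (K_mul_E b q i j)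

theorem Kinv_mul_F (i j : b.support) :
    Kinv b q i * F b q j = (q : k) ^ normForm P i j • (F b q j * Kinv b q i) := by
  have := Kinv_comm_of b q (zpow_ne_zero _ q.ne_zero) (K_mul_F b q i j)
  rwa [← zpow_neg, neg_neg] at this

theorem Kinv_mul_K_comm (i j : b.support) : Kinv b q i * K b q j = K b q j * Kinv b q i := by
  have := Kinv_comm_of b q (i := i) (x := K b q j) one_ne_zero (by simpa using K_mul_K b q i j)
  simpa using this

theorem Kinv_mul_Kinv (i j : b.support) : Kinv b q i * Kinv b q j = Kinv b q j * Kinv b q i := by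
  have := Kinv_comm_of b q (i := i) (x := Kinv b q j) one_ne_zero
    (by simpa using (Kinv_mul_K_comm b q j i).symm)
  simpa using this

theorem E_mul_F_self (i : b.support) : E b q i * F b q i - F b q i * E b q i
    = ((qRoot q P i : k) - (qRoot q P i : k)⁻¹)⁻¹ • (K b q i - Kinv b q i) := by
  simpa [E, F, K, Kinv] using mk_eq b q (.E_mul_F_self i)

theorem E_mul_F_of_ne {i j : b.support} (h : i ≠ j) :
    E b q i * F b q j - F b q j * E b q i = 0 := by
  simpa [E, F, K, Kinv] using mk_eq b q (.E_mul_F_of_ne i j h)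

theorem serre_E {i j : b.support} (h : i ≠ j) :
    serreElement (qRoot q P i) (1 - P.pairingIn ℤ j i).toNat (E b q i) (E b q j) = 0 := by
  have := mk_eq b q (.serre_E i j h)
  rwa [map_serreElement, map_zero] at this

theorem serre_F {i j : b.support} (h : i ≠ j) :
    serreElement (qRoot q P i) (1 - P.pairingIn ℤ j i).toNat (F b q i) (F b q j) = 0 := by
  have := mk_eq b q (.serre_F i j h)
  rwa [map_serreElement, map_zero] at this

theorem toNat_eq {i j : b.support} (h : i ≠ j) :
    (1 - ((1 - P.pairingIn ℤ j i).toNat : ℤ)) = P.pairingIn ℤ j i := by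
  have := b.pairingIn_le_zero_of_ne (fun h' => h (Subtype.ext h'.symm)) j.2 i.2
  lia

variable {b q}

theorem algHom_ext {B : Type*} [Semiring B] [Algebra k B] {f g : Uq b q →ₐ[k] B}
    (hE : ∀ i, f (E b q i) = g (E b q i)) (hF : ∀ i, f (F b q i) = g (F b q i))
    (hK : ∀ i, f (K b q i) = g (K b q i)) (hKinv : ∀ i, f (Kinv b q i) = g (Kinv b q i)) :
    f = g := by
  refine RingQuot.ringQuot_ext' k f g (FreeAlgebra.hom_ext (funext fun x => ?_))
  cases x with
  | E i => exact hE i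
  | F i => exact hF i
  | K i => exact hK i
  | Kinv i => exact hKinv i

def lift {B : Type*} [Semiring B] [Algebra k B] (f : FreeAlgebra k (Gen b.support) →ₐ[k] B)
    (h : ∀ ⦃x y⦄, Rel b q x y → f x = f y) : Uq b q →ₐ[k] B :=
  RingQuot.liftAlgHom k ⟨f, h⟩

theorem lift_mk {B : Type*} [Semiring B] [Algebra k B] (f : FreeAlgebra k (Gen b.support) →ₐ[k] B)
    (h : ∀ ⦃x y⦄, Rel b q x y → f x = f y) (x : FreeAlgebra k (Gen b.support)) :
    lift f h (mk b q x) = f x :=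
  RingQuot.liftAlgHom_mkAlgHom_apply k f h x

variable (b q)

/-- The coproduct on generators: `Δ E = E ⊗ 1 + K ⊗ E`, `Δ F = F ⊗ K⁻¹ + 1 ⊗ F`, `Δ K = K ⊗ K`. -/
def comulFree : FreeAlgebra k (Gen b.support) →ₐ[k] Uq b q ⊗[k] Uq b q :=
  FreeAlgebra.lift k fun
    | .E i => E b q i ⊗ₜ 1 + K b q i ⊗ₜ E b q i
    | .F i => F b q i ⊗ₜ Kinv b q i + 1 ⊗ₜ F b q i
    | .K i => K b q i ⊗ₜ K b q i
    | .Kinv i => Kinv b q i ⊗ₜ Kinv b q i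

def counitFree : FreeAlgebra k (Gen b.support) →ₐ[k] k :=
  FreeAlgebra.lift k fun
    | .E _ => 0
    | .F _ => 0
    | .K _ => 1
    | .Kinv _ => 1

theorem counitFree_rel ⦃x y : FreeAlgebra k (Gen b.support)⦄ (h : Rel b q x y) :
    counitFree (k := k) b x = counitFree (k := k) b y := by
  have hE (i) : counitFree (k := k) b (FreeAlgebra.ι k (.E i)) = 0 := by simp [counitFree]
  have hF (i) : counitFree (k := k) b (FreeAlgebra.ι k (.F i)) = 0 := by simp [counitFree]
  have hK (i) : counitFree (k := k) b (FreeAlgebra.ι k (.K i)) = 1 := by simp [counitFree]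
  have hKinv (i) : counitFree (k := k) b (FreeAlgebra.ι k (.Kinv i)) = 1 := by simp [counitFree]
  induction h <;>
    simp [hE, hF, hK, hKinv, serreElement]

/-- The counit of `Uq b q`. -/
def counitHom : Uq b q →ₐ[k] k := lift (counitFree b) (counitFree_rel b q)

theorem counitHom_E (i : b.support) : counitHom b q (E b q i) = 0 := by
  rw [E, counitHom, lift_mk]; simp [counitFree]

theorem counitHom_F (i : b.support) : counitHom b q (F b q i) = 0 := by
  rw [F, counitHom, lift_mk]; simp [counitFree]

theorem counitHom_K (i : b.support) : counitHom b q (K b q i) = 1 := by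
  rw [K, counitHom, lift_mk]; simp [counitFree]

theorem counitHom_Kinv (i : b.support) : counitHom b q (Kinv b q i) = 1 := by
  rw [Kinv, counitHom, lift_mk]; simp [counitFree]

variable [P.IsReduced]

variable {b q} in
theorem qRoot_zpow (i j : b.support) :
    (qRoot q P i : k) ^ P.pairingIn ℤ j i = (q : k) ^ normForm P i j := by
  rw [normForm_eq, zpow_mul, qRoot, Units.val_zpow_eq_zpow_val]

variable {b q} in
theorem qRoot_sq (i : b.support) :
    (qRoot q P i : k) ^ (2 : ℤ) = (q : k) ^ normForm P i i := by
  rw [← qRoot_zpow]; simp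

theorem comulFree_rel ⦃x y : FreeAlgebra k (Gen b.support)⦄ (h : Rel b q x y) :
    comulFree b q x = comulFree b q y := by
  have hE (i) : comulFree b q (FreeAlgebra.ι k (.E i)) = E b q i ⊗ₜ 1 + K b q i ⊗ₜ E b q i := by
    simp [comulFree]
  have hF (i) : comulFree b q (FreeAlgebra.ι k (.F i))
      = F b q i ⊗ₜ Kinv b q i + 1 ⊗ₜ F b q i := by
    simp [comulFree]
  have hK (i) : comulFree b q (FreeAlgebra.ι k (.K i)) = K b q i ⊗ₜ K b q i := by
    simp [comulFree]
  have hKinv (i) : comulFree b q (FreeAlgebra.ι k (.Kinv i)) = Kinv b q i ⊗ₜ Kinv b q i := by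
    simp [comulFree]
  have hq : (q : k) ≠ 0 := q.ne_zero
  have cross (i j : b.support) : (E b q i ⊗ₜ 1 + K b q i ⊗ₜ E b q i) *
        (F b q j ⊗ₜ Kinv b q j + 1 ⊗ₜ F b q j)
      - (F b q j ⊗ₜ Kinv b q j + 1 ⊗ₜ F b q j) * (E b q i ⊗ₜ 1 + K b q i ⊗ₜ E b q i)
      = (E b q i * F b q j - F b q j * E b q i) ⊗ₜ[k] Kinv b q j
        + K b q i ⊗ₜ[k] (E b q i * F b q j - F b q j * E b q i) := by
    have e : E b q i * Kinv b q j = (q : k) ^ normForm P i j • (Kinv b q j * E b q i) := by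
      rw [Kinv_mul_E, smul_smul, ← zpow_add₀ hq, normForm_symm (j : J) i, add_neg_cancel, zpow_zero,
        one_smul]
    have e2 : (K b q i * F b q j) ⊗ₜ[k] (E b q i * Kinv b q j)
        = (F b q j * K b q i) ⊗ₜ[k] (Kinv b q j * E b q i) := by
      rw [K_mul_F, e, TensorProduct.tmul_smul, TensorProduct.smul_tmul', smul_smul,
        ← zpow_add₀ hq, add_neg_cancel, zpow_zero, one_smul]
    simp only [add_mul, mul_add, Algebra.TensorProduct.tmul_mul_tmul, one_mul, mul_one, e2,
      TensorProduct.tmul_sub, TensorProduct.sub_tmul]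
    abel
  induction h with
  | K_mul_Kinv i => simp [hK, hKinv, K_mul_Kinv, Algebra.TensorProduct.one_def]
  | Kinv_mul_K i => simp [hK, hKinv, Kinv_mul_K, Algebra.TensorProduct.one_def]
  | K_mul_K i j => simp [hK, K_mul_K b q i j]
  | K_mul_E i j =>
    simp only [map_mul, map_smul, hK, hKinv, hE, add_mul, mul_add,
      Algebra.TensorProduct.tmul_mul_tmul, mul_one, K_E_Kinv, K_mul_K b q i j, smul_add,
      TensorProduct.tmul_smul, TensorProduct.smul_tmul', K_mul_Kinv]
    rw [mul_assoc, K_mul_Kinv, mul_one]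
  | K_mul_F i j =>
    simp only [map_mul, map_smul, hK, hKinv, hF, add_mul, mul_add,
      Algebra.TensorProduct.tmul_mul_tmul, mul_one, K_F_Kinv, smul_add,
      ← Kinv_mul_K_comm b q j i, TensorProduct.tmul_smul, ← TensorProduct.smul_tmul', K_mul_Kinv]
    rw [mul_assoc, K_mul_Kinv, mul_one]
  | E_mul_F_self i =>
    simp only [map_mul, map_sub, map_smul, hE, hF, hK, hKinv]
    rw [cross, E_mul_F_self, TensorProduct.tmul_smul, ← TensorProduct.smul_tmul', ← smul_add,
      TensorProduct.tmul_sub, TensorProduct.sub_tmul]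
    congr 1
    abel
  | E_mul_F_of_ne i j hij =>
    simp only [map_mul, map_sub, map_zero, hE, hF]
    rw [cross, E_mul_F_of_ne b q hij]
    simp
  | serre_E i j hij =>
    rw [map_serreElement, map_zero, hE, hE]
    refine serreElement_tmul _ _ ?_ ?_ ?_ (K_mul_K b q j i) (serre_E b q hij)
    · rw [qRoot_sq, K_mul_E]
    · rw [toNat_eq b hij, qRoot_zpow, K_mul_E]
    · rw [toNat_eq b hij, qRoot_zpow, K_mul_E, normForm_symm]
  | serre_F i j hij =>
    rw [map_serreElement, map_zero, hF, hF]
    apply (Algebra.TensorProduct.comm k (Uq b q) (Uq b q)).injective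
    rw [map_zero, ← AlgEquiv.coe_toAlgHom, map_serreElement]
    simp only [AlgEquiv.coe_toAlgHom, map_add, Algebra.TensorProduct.comm_tmul]
    rw [add_comm (Kinv b q i ⊗ₜ[k] F b q i), add_comm (Kinv b q j ⊗ₜ[k] F b q j)]
    refine serreElement_tmul _ _ ?_ ?_ ?_ (Kinv_mul_Kinv b q j i) (serre_F b q hij)
    · rw [qRoot_sq, Kinv_mul_F]
    · rw [toNat_eq b hij, qRoot_zpow, Kinv_mul_F]
    · rw [toNat_eq b hij, qRoot_zpow, Kinv_mul_F, normForm_symm]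

/-- The coproduct of `Uq b q`, as an algebra homomorphism. -/
def comulHom : Uq b q →ₐ[k] Uq b q ⊗[k] Uq b q := lift (comulFree b q) (comulFree_rel b q)

theorem comulHom_E (i : b.support) :
    comulHom b q (E b q i) = E b q i ⊗ₜ 1 + K b q i ⊗ₜ E b q i := by
  rw [E, comulHom, lift_mk]; simp [comulFree, E]

theorem comulHom_F (i : b.support) :
    comulHom b q (F b q i) = F b q i ⊗ₜ Kinv b q i + 1 ⊗ₜ F b q i := by
  rw [F, comulHom, lift_mk]; simp [comulFree, F]

theorem comulHom_K (i : b.support) : comulHom b q (K b q i) = K b q i ⊗ₜ K b q i := by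
  rw [K, comulHom, lift_mk]; simp [comulFree, K]

theorem comulHom_Kinv (i : b.support) :
    comulHom b q (Kinv b q i) = Kinv b q i ⊗ₜ Kinv b q i := by
  rw [Kinv, comulHom, lift_mk]; simp [comulFree, Kinv]

instance : Bialgebra k (Uq b q) :=
  Bialgebra.ofAlgHom (comulHom b q) (counitHom b q)
    (by
      apply algHom_ext <;> intro i <;>
        simp [comulHom_E, comulHom_F, comulHom_K, comulHom_Kinv, TensorProduct.add_tmul,
          TensorProduct.tmul_add, add_assoc, Algebra.TensorProduct.one_def])
    (by
      apply algHom_ext <;> intro i <;>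
        simp [comulHom_E, comulHom_F, comulHom_K, comulHom_Kinv, counitHom_E, counitHom_F,
          counitHom_K, counitHom_Kinv])
    (by
      apply algHom_ext <;> intro i <;>
        simp [comulHom_E, comulHom_F, comulHom_K, comulHom_Kinv, counitHom_E, counitHom_F,
          counitHom_K, counitHom_Kinv])

end Uq

section Subalgebras
variable (b : P.Base) (q : kˣ)

/-- `U⁺`, the subalgebra generated by all `E_α`. -/
def Upos : Subalgebra k (Uq b q) := Algebra.adjoin k (Set.range (Uq.E b q))

/-- `U⁻`, the subalgebra generated by all `F_α`. -/
def Uneg : Subalgebra k (Uq b q) := Algebra.adjoin k (Set.range (Uq.F b q))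

/-- `U⁰`, the subalgebra generated by all `K_α` and `K_α⁻¹`. -/
def Uzero : Subalgebra k (Uq b q) :=
  Algebra.adjoin k (Set.range (Uq.K b q) ∪ Set.range (Uq.Kinv b q))

end Subalgebras
end Algebra

/-- A subalgebra `C` of a bialgebra `A` is a right coideal subalgebra if `Δ(C) ⊆ C ⊗ A`. -/
def IsRightCoidealSubalgebra {k A : Type*} [Field k] [Ring A] [Bialgebra k A]
    (C : Subalgebra k A) : Prop :=
  ∀ c ∈ C, Coalgebra.comul (R := k) c ∈
    LinearMap.range (LinearMap.rTensor A (Subalgebra.toSubmodule C).subtype)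

end QuantizedEnveloping
end

/-! Replace `F_α` by `F_α K_α`: then `Δ(F_α K_α) = F_α K_α ⊗ 1 + K_α ⊗ F_α K_α`, the same shape as
`Δ(E_α)`. Since `q` is not a root of unity and the form on the root lattice is nondegenerate, some
torus element `g` grades `U` by height under conjugation. The subalgebra `C` is graded too, as it
contains `U⁰`.

Surjectivity. Write `c ∈ C` as a combination of monomials `(FK)_v h E_w` with `h` a torus monomial.
Passing to a homogeneous component, `|w| - |v|` is constant. Now grade `Δ(c)` by the height of its
second tensor factor. The part of lowest height comes from the terms with `|v|` maximal, where a
monomial contributes `K_v h E_w ⊗ (FK)_v h`; the part of highest height comes from those with `|w|`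
maximal, where it contributes `(FK)_v h K_w ⊗ h E_w`. Both parts lie in `C ⊗ U`, and the second
factors are linearly independent, so coefficients can be read off; torus factors are units of `C`.
By homogeneity `|v|` and `|w|` are maximal for the same terms. Hence for each `h` the top
coefficient matrix has all its rows in `U⁺ ∩ C` and all its columns in `UFK ∩ C`, where `UFK` is
generated by the `F_α K_α`. Such a tensor lies in `(UFK ∩ C) ⊗ (U⁺ ∩ C)`. The top part of `c` is
thus in `(UFK ∩ C) U⁰ (U⁺ ∩ C) ⊆ C`; subtract it and induct (`sum_E_mem`, `sum_FK_mem`,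
`sum_bilin_mem`, `sum_monomial_mem_of_homogeneous`). Finally `UFK ∩ C` splits into weight
components, and in each of them `(FK)_v` is a scalar times `F_v` times one fixed torus unit, so `UFK
∩ C ⊆ (U⁻ ∩ C) U⁰` (`UFK_inf_le`).

Injectivity. It suffices to treat `U⁻ ⊗ U⁰ ⊗ U⁺ → U`. The same leading terms, together with the
independence of distinct group-like elements, show that the products `F_v h E_w` are independent
when `F_v` and `E_w` run over bases of `U⁻` and `U⁺` made of words
(`linearIndependent_F_mul_torus_mul_E`). Neither a PBW basis nor representation theory enters. -/

namespace QuantizedEnveloping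

/-! ### Eigenvector sums and coefficients of tensors -/

section LinearAlgebra
variable {k V W : Type*} [Field k] [AddCommGroup V] [Module k V] [AddCommGroup W] [Module k W]

/-- Induction on the set `Γ` of eigenvalues to be removed: `f - δ` preserves `p`, kills the `δ`-part
and multiplies the `γ`-part by `γ - δ`, which is invertible when `δ ≠ γ`. -/
theorem sum_filter_eigenvectors_mem_of_finset {ι : Type*} [DecidableEq k] (f : V →ₗ[k] V)
    {p : Submodule k V} (hp : ∀ x ∈ p, f x ∈ p) (γ : k) (Γ : Finset k) :
    ∀ (s : Finset ι) (v : ι → V) (c : ι → k), (∀ a ∈ s, f (v a) = c a • v a) →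
      (∀ a ∈ s, c a = γ ∨ c a ∈ Γ) → ∑ a ∈ s, v a ∈ p → ∑ a ∈ s with c a = γ, v a ∈ p := by
  induction Γ using Finset.induction_on with
  | empty =>
    intro s v c _ hc hs
    rwa [Finset.filter_true_of_mem fun a ha => by simpa using hc a ha]
  | insert δ Γ _ ih =>
    intro s v c hv hc hs
    by_cases hδ : δ = γ
    · exact ih s v c hv (fun a ha => by have := hc a ha; grind) hs
    have h1 : ∑ a ∈ s, (c a - δ) • v a ∈ p := by
      have : ∑ a ∈ s, (c a - δ) • v a = f (∑ a ∈ s, v a) - δ • ∑ a ∈ s, v a := by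
        rw [map_sum, Finset.smul_sum, ← Finset.sum_sub_distrib]
        exact Finset.sum_congr rfl fun a ha => by rw [hv a ha, sub_smul]
      rw [this]
      exact p.sub_mem (hp _ hs) (p.smul_mem _ hs)
    have h2 : ∑ a ∈ s with c a ≠ δ, (c a - δ) • v a ∈ p := by
      rwa [Finset.sum_filter_of_ne]
      intro a _ h hcd
      simp [hcd] at h
    have h3 := ih (s.filter fun a => c a ≠ δ) (fun a => (c a - δ) • v a) c
      (fun a ha => by rw [map_smul, hv a (Finset.mem_of_mem_filter a ha), smul_comm])
      (fun a ha => by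
        have := hc a (Finset.mem_of_mem_filter a ha); have := (Finset.mem_filter.mp ha).2; grind) h2
    rw [Finset.filter_filter] at h3
    have h4 : ∑ a ∈ s with c a ≠ δ ∧ c a = γ, (c a - δ) • v a
        = (γ - δ) • ∑ a ∈ s with c a = γ, v a := by
      rw [Finset.smul_sum]
      refine Finset.sum_congr (Finset.filter_congr fun a _ => ?_) fun a ha => ?_
      · grind
      · rw [(Finset.mem_filter.mp ha).2]
    rw [h4] at h3
    exact (p.smul_mem_iff (sub_ne_zero.mpr (Ne.symm hδ))).mp h3

/-- If a sum of eigenvectors of `f` lies in an `f`-stable subspace, so does the partial sum over each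
eigenvalue. -/
theorem sum_filter_eigenvectors_mem {ι : Type*} [DecidableEq k] (f : V →ₗ[k] V)
    {p : Submodule k V} (hp : ∀ x ∈ p, f x ∈ p) (γ : k) (s : Finset ι) (v : ι → V) (c : ι → k)
    (hv : ∀ a ∈ s, f (v a) = c a • v a) (hs : ∑ a ∈ s, v a ∈ p) :
    ∑ a ∈ s with c a = γ, v a ∈ p :=
  sum_filter_eigenvectors_mem_of_finset f hp γ (s.image c) s v c hv
    (fun _ ha => Or.inr (Finset.mem_image_of_mem c ha)) hs

/-- Coordinates with respect to `v`, extended from its span to all of `V`. -/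
theorem exists_dual_family {ι : Type*} {v : ι → V} (hv : LinearIndependent k v) :
    ∃ φ : V →ₗ[k] (ι →₀ k), ∀ i, φ (v i) = Finsupp.single i 1 := by
  obtain ⟨φ, hφ⟩ := LinearMap.exists_leftInverse_of_injective (Finsupp.linearCombination k v)
    (LinearMap.ker_eq_bot.mpr hv)
  refine ⟨φ, fun i => ?_⟩
  simpa using LinearMap.congr_fun hφ (Finsupp.single i 1)

/-- Coefficients in `V` of linearly independent vectors, read off from a tensor in `p ⊗ W`. -/
theorem mem_of_sum_tmul_mem {ι : Type*} {p : Submodule k V} {v : ι → W}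
    (hv : LinearIndependent k v) {s : Finset ι} {x : ι → V}
    (h : ∑ i ∈ s, x i ⊗ₜ[k] v i ∈ LinearMap.range (LinearMap.rTensor W p.subtype))
    {i : ι} (hi : i ∈ s) : x i ∈ p := by
  classical
  obtain ⟨φ, hφ⟩ := exists_dual_family hv
  -- The slice map `id ⊗ (i-th coordinate)`: it carries `p ⊗ W` into `p` and picks out `x i`.
  let ψ : V ⊗[k] W →ₗ[k] V :=
    TensorProduct.lift ((LinearMap.lsmul k V).flip.compr₂ LinearMap.id |>.compl₂
      (Finsupp.lapply i ∘ₗ φ))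
  have hψ (x : V) (w : W) : ψ (x ⊗ₜ w) = φ w i • x := by simp [ψ]
  have h1 : ∀ z ∈ LinearMap.range (LinearMap.rTensor W p.subtype), ψ z ∈ p := by
    rintro _ ⟨z, rfl⟩
    induction z with
    | zero => simp
    | add y z hy hz => rw [map_add, map_add]; exact p.add_mem hy hz
    | tmul y w => simpa [hψ] using p.smul_mem _ y.2
  have h2 := h1 _ h
  rw [map_sum, Finset.sum_eq_single i] at h2
  · simpa [hψ, hφ] using h2
  · intro j _ hj
    simp [hψ, hφ, hj]
  · exact fun h => absurd hi h

/-- Variant in which the same vector may occur several times in the second factor: its coefficient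
is the sum over a fibre of `π`. -/
theorem sum_filter_mem_of_sum_tmul_mem {σ ι : Type*} [DecidableEq ι] {p : Submodule k V}
    {v : ι → W} (hv : LinearIndependent k v) {s : Finset σ} {x : σ → V} {π : σ → ι}
    (h : ∑ a ∈ s, x a ⊗ₜ[k] v (π a) ∈ LinearMap.range (LinearMap.rTensor W p.subtype)) (i : ι) :
    ∑ a ∈ s with π a = i, x a ∈ p := by
  by_cases hi : i ∈ s.image π
  · refine mem_of_sum_tmul_mem (x := fun i => ∑ a ∈ s with π a = i, x a) hv (s := s.image π) ?_ hi
    rw [← Finset.sum_fiberwise_of_maps_to (fun a ha => Finset.mem_image_of_mem π ha)] at h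
    convert h using 2 with i
    rw [TensorProduct.sum_tmul]
    exact Finset.sum_congr rfl fun a ha => by rw [(Finset.mem_filter.mp ha).2]
  · rw [Finset.sum_eq_zero]
    · exact p.zero_mem
    · intro a ha
      rw [Finset.mem_filter] at ha
      exact absurd (Finset.mem_image.mpr ⟨a, ha⟩) hi

/-- A linear relation is a tensor in `⊥ ⊗ W`, so reading off coefficients gives a relation within
each fibre of `π`. -/
theorem linearIndependent_tmul {σ ι : Type*} {v : ι → W} (hv : LinearIndependent k v)
    {x : σ → V} {π : σ → ι} (hx : ∀ i, LinearIndepOn k x {a | π a = i}) :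
    LinearIndependent k fun a => x a ⊗ₜ[k] v (π a) := by
  classical
  rw [linearIndependent_iff']
  intro s f hs a ha
  have h1 : ∑ a ∈ s, (f a • x a) ⊗ₜ[k] v (π a)
      ∈ LinearMap.range (LinearMap.rTensor W (⊥ : Submodule k V).subtype) := by
    simp only [← TensorProduct.smul_tmul', hs]
    exact Submodule.zero_mem _
  have h2 := sum_filter_mem_of_sum_tmul_mem hv h1 (π a)
  exact linearIndepOn_iff'.mp (hx (π a)) _ f (fun c hc => (Finset.mem_filter.mp hc).2)
    (by simpa using h2) a (by simp [ha])

theorem linearIndependent_tmul' {σ ι : Type*} {v : ι → V} (hv : LinearIndependent k v)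
    {x : σ → W} {π : σ → ι} (hx : ∀ i, LinearIndepOn k x {a | π a = i}) :
    LinearIndependent k fun a => v (π a) ⊗ₜ[k] x a :=
  (linearIndependent_tmul hv hx).map' (TensorProduct.comm k W V).toLinearMap
    (LinearEquiv.ker _)

/-- A tensor all of whose rows lie in `P` and all of whose columns lie in `M` lies in `M ⊗ P`;
stated after evaluation of a bilinear map. -/
theorem sum_bilin_mem {σ ι κ X : Type*} [DecidableEq ι] [DecidableEq κ] [AddCommGroup X]
    [Module k X] (B : V →ₗ[k] W →ₗ[k] X)
    {M : Submodule k V} {P : Submodule k W} {q : Submodule k X}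
    (hq : ∀ m ∈ M, ∀ p ∈ P, B m p ∈ q) (s : Finset σ) (α : σ → ι) (β : σ → κ) (c : σ → k)
    (f : ι → V) (e : κ → W) (hrow : ∀ i, ∑ a ∈ s with α a = i, c a • e (β a) ∈ P)
    (hcol : ∀ j, ∑ a ∈ s with β a = j, c a • f (α a) ∈ M) :
    ∑ a ∈ s, c a • B (f (α a)) (e (β a)) ∈ q := by
  -- Applying a projection onto `P` in the second variable does not change the sum, since every row
  -- is already in `P`. Afterwards each column contributes `B m p` with `m ∈ M` and `p ∈ P`.
  obtain ⟨πP, hP⟩ := LinearMap.exists_leftInverse_of_injective P.subtype P.ker_subtype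
  have hP' (x : W) (hx : x ∈ P) : (πP x : W) = x :=
    congrArg Subtype.val (LinearMap.congr_fun hP ⟨x, hx⟩)
  have h1 : ∑ a ∈ s, c a • B (f (α a)) (e (β a))
      = ∑ a ∈ s, c a • B (f (α a)) (πP (e (β a))) := by
    rw [← Finset.sum_fiberwise_of_maps_to fun a ha => Finset.mem_image_of_mem α ha,
      ← Finset.sum_fiberwise_of_maps_to (g := α) fun a ha => Finset.mem_image_of_mem α ha]
    refine Finset.sum_congr rfl fun i _ => ?_
    have h2 := congrArg (B (f i)) (hP' _ (hrow i))
    simp only [map_sum, map_smul, Submodule.coe_sum, Submodule.coe_smul] at h2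
    have h3 (y : σ → W) : ∑ a ∈ s with α a = i, c a • B (f (α a)) (y a)
        = ∑ a ∈ s with α a = i, c a • B (f i) (y a) :=
      Finset.sum_congr rfl fun a ha => by rw [(Finset.mem_filter.mp ha).2]
    rw [h3, h3, h2]
  rw [h1, ← Finset.sum_fiberwise_of_maps_to fun a ha => Finset.mem_image_of_mem β ha]
  refine q.sum_mem fun j _ => ?_
  have h2 := hq _ (hcol j) _ (πP (e j)).2
  simp only [map_sum, map_smul, LinearMap.sum_apply, LinearMap.smul_apply] at h2
  convert h2 using 2 with a ha
  rw [(Finset.mem_filter.mp ha).2]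

end LinearAlgebra

/-! ### Weights under conjugation and leading terms -/

section Weights
variable {k R : Type*} [Field k] [Ring R] [Algebra k R]

theorem zpow_injective_of_pow_ne_one {t : kˣ} (ht : ∀ n : ℕ, 0 < n → (t : k) ^ n ≠ 1) :
    Function.Injective fun n : ℤ => (t : k) ^ n := by
  have hlt {a b : ℤ} (hab : a < b) : (t : k) ^ b ≠ (t : k) ^ a := by
    intro h
    refine ht (b - a).toNat (by lia) ?_
    rw [← zpow_natCast, Int.toNat_of_nonneg (by lia), zpow_sub₀ t.ne_zero, h,
      div_self (zpow_ne_zero _ t.ne_zero)]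
  intro a b h
  rcases lt_trichotomy a b with hab | hab | hab
  exacts [absurd h.symm (hlt hab), hab, absurd h (hlt hab)]

/-- The elements of weight `n` for conjugation by `G`. -/
def weightSpace (G : R) (t : kˣ) (n : ℤ) : Submodule k R where
  carrier := {z | G * z = (t : k) ^ n • (z * G)}
  zero_mem' := by simp
  add_mem' {x y} hx hy := by
    simp only [Set.mem_ofPred_eq] at *
    rw [mul_add, hx, hy, add_mul, smul_add]
  smul_mem' c x hx := by
    simp only [Set.mem_ofPred_eq] at *
    rw [mul_smul_comm, hx, smul_mul_assoc, smul_comm]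

theorem mem_weightSpace {G : R} {t : kˣ} {n : ℤ} {z : R} :
    z ∈ weightSpace G t n ↔ G * z = (t : k) ^ n • (z * G) := Iff.rfl

theorem weightSpace_mul {G : R} {t : kˣ} {m n : ℤ} {x y : R} (hx : x ∈ weightSpace G t m)
    (hy : y ∈ weightSpace G t n) : x * y ∈ weightSpace G t (m + n) := by
  rw [mem_weightSpace] at *
  rw [← mul_assoc, hx, smul_mul_assoc, mul_assoc, hy, mul_smul_comm, smul_smul,
    zpow_add₀ t.ne_zero, mul_assoc]

theorem weightSpace_of_inverse {G G' : R} {t : kˣ} {n : ℤ} {z : R} (h : G' * G = 1)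
    (h' : G * G' = 1) (hz : z ∈ weightSpace G t n) : z ∈ weightSpace G' t (-n) := by
  rw [mem_weightSpace] at *
  have h1 : G' * (G * z) * G' = z * G' := by rw [← mul_assoc, h, one_mul]
  rw [← h1, hz, mul_smul_comm, smul_mul_assoc, smul_smul, ← zpow_add₀ t.ne_zero, neg_add_cancel,
    zpow_zero, one_smul, mul_assoc, mul_assoc, h', mul_one]

theorem weightSpace_list_prod {I : Type*} {G : R} {t : kˣ} {d : I → ℤ} {X : I → R}
    (h : ∀ i, X i ∈ weightSpace G t (d i)) (w : List I) :
    (w.map X).prod ∈ weightSpace G t (w.map d).sum := by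
  induction w with
  | nil => simp [mem_weightSpace]
  | cons i w ih => simpa using weightSpace_mul (h i) ih

theorem tmul_mem_weightSpace {G : R} {t : kˣ} {n : ℤ} {x : R} (hx : x ∈ weightSpace G t n)
    (y : R) : y ⊗ₜ[k] x ∈ weightSpace ((1 : R) ⊗ₜ[k] G) t n := by
  rw [mem_weightSpace] at *
  simp [hx]

/-- Sums of elements of weight at most `n`. -/
def weightLE (G : R) (t : kˣ) (n : ℤ) : Submodule k R :=
  Submodule.span k {z | ∃ m ≤ n, z ∈ weightSpace G t m}

theorem weightLE_mono {G : R} {t : kˣ} {m n : ℤ} (h : m ≤ n) :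
    weightLE G t m ≤ weightLE G t n :=
  Submodule.span_mono fun _ ⟨l, hl, hz⟩ => ⟨l, hl.trans h, hz⟩

theorem weightSpace_le_weightLE (G : R) (t : kˣ) (n : ℤ) :
    weightSpace G t n ≤ weightLE G t n :=
  fun _ hz => Submodule.subset_span ⟨n, le_rfl, hz⟩

theorem weightLE_mul {G : R} {t : kˣ} {m n : ℤ} {x y : R} (hx : x ∈ weightLE G t m)
    (hy : y ∈ weightLE G t n) : x * y ∈ weightLE G t (m + n) := by
  have h : weightLE G t m * weightLE G t n ≤ weightLE G t (m + n) := by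
    rw [weightLE, weightLE, Submodule.span_mul_span, Submodule.span_le]
    rintro _ ⟨a, ⟨i, hi, ha⟩, b, ⟨j, hj, hb⟩, rfl⟩
    exact Submodule.subset_span ⟨i + j, add_le_add hi hj, weightSpace_mul ha hb⟩
  exact h (Submodule.mul_mem_mul hx hy)

/-- `z₀` is the component of weight `n` of `z`, and all other components have smaller weight. -/
def HasLeadingTerm (G : R) (t : kˣ) (z : R) (n : ℤ) (z₀ : R) : Prop :=
  z₀ ∈ weightSpace G t n ∧ z - z₀ ∈ weightLE G t (n - 1)

namespace HasLeadingTerm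
variable {G : R} {t : kˣ}

theorem of_mem {z : R} {n : ℤ} (h : z ∈ weightSpace G t n) : HasLeadingTerm G t z n z :=
  ⟨h, by simp⟩

theorem add_of_mem {x y : R} {m n : ℤ} (hx : x ∈ weightSpace G t n) (hy : y ∈ weightSpace G t m)
    (h : m < n) : HasLeadingTerm G t (x + y) n x :=
  ⟨hx, by
    rw [add_sub_cancel_left]
    exact weightLE_mono (by lia) (weightSpace_le_weightLE G t m hy)⟩

theorem mem_weightLE {z z₀ : R} {n : ℤ} (h : HasLeadingTerm G t z n z₀) : z ∈ weightLE G t n := by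
  rw [← sub_add_cancel z z₀]
  exact add_mem (weightLE_mono (by lia) h.2) (weightSpace_le_weightLE G t n h.1)

theorem mul {x y x₀ y₀ : R} {m n : ℤ} (hx : HasLeadingTerm G t x m x₀)
    (hy : HasLeadingTerm G t y n y₀) : HasLeadingTerm G t (x * y) (m + n) (x₀ * y₀) := by
  refine ⟨weightSpace_mul hx.1 hy.1, ?_⟩
  have e : x * y - x₀ * y₀ = (x - x₀) * y + x₀ * (y - y₀) := by noncomm_ring
  rw [e]
  refine add_mem ?_ ?_
  · have := weightLE_mul hx.2 hy.mem_weightLE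
    rwa [show m + n - 1 = m - 1 + n by ring]
  · have := weightLE_mul (weightSpace_le_weightLE G t m hx.1) hy.2
    rwa [show m + n - 1 = m + (n - 1) by ring]

theorem list_prod {I : Type*} {Z Z₀ : I → R} {d : ℤ} (h : ∀ i, HasLeadingTerm G t (Z i) d (Z₀ i))
    (w : List I) : HasLeadingTerm G t (w.map Z).prod (w.length * d) (w.map Z₀).prod := by
  induction w with
  | nil => simpa using of_mem (G := G) (t := t) (z := 1) (n := 0) (by simp [mem_weightSpace])
  | cons i w ih =>
    have := (h i).mul ih
    simp only [List.map_cons, List.prod_cons, List.length_cons]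
    rwa [show ((w.length + 1 : ℕ) : ℤ) * d = d + w.length * d by push_cast; ring]

/-- A subspace stable under conjugation by `G` contains the weight components of its elements. The
component of weight `N` of the sum is the sum of the leading terms of that weight, because no
summand reaches higher. -/
theorem sum_filter_mem {ι : Type*} {G' : R} (hG : G * G' = 1)
    (ht : ∀ n : ℕ, 0 < n → (t : k) ^ n ≠ 1)
    {p : Submodule k R} (hp : ∀ z ∈ p, G * z * G' ∈ p) {s : Finset ι} {f : ι → k} {z z₀ : ι → R}
    {n : ι → ℤ} (hz : ∀ a ∈ s, HasLeadingTerm G t (z a) (n a) (z₀ a)) {N : ℤ}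
    (hN : ∀ a ∈ s, n a ≤ N) (hs : ∑ a ∈ s, f a • z a ∈ p) :
    ∑ a ∈ s with n a = N, f a • z₀ a ∈ p := by
  classical
  set u := ∑ a ∈ s with n a = N, f a • z₀ a with hu
  have hr : ∑ a ∈ s, f a • z a - u ∈ weightLE G t (N - 1) := by
    rw [hu, ← Finset.sum_filter_add_sum_filter_not s (fun a => n a = N), add_sub_right_comm,
      ← Finset.sum_sub_distrib]
    refine add_mem (Submodule.sum_mem _ fun a ha => ?_) (Submodule.sum_mem _ fun a ha => ?_)
    · rw [Finset.mem_filter] at ha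
      rw [← smul_sub, ← ha.2]
      exact Submodule.smul_mem _ _ (hz a ha.1).2
    · rw [Finset.mem_filter] at ha
      have := hN a ha.1
      exact Submodule.smul_mem _ _ (weightLE_mono (by lia) (hz a ha.1).mem_weightLE)
  have hu' : u ∈ weightSpace G t N := by
    refine Submodule.sum_mem _ fun a ha => ?_
    rw [Finset.mem_filter] at ha
    rw [← ha.2]
    exact Submodule.smul_mem _ _ (hz a ha.1).1
  obtain ⟨l, c, g, hg⟩ := Submodule.mem_span_set'.mp hr
  choose m hm hmg using fun i => (g i).2
  let T : R →ₗ[k] R := LinearMap.mulRight k G' ∘ₗ LinearMap.mulLeft k G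
  have hT {x : R} {n : ℤ} (hx : x ∈ weightSpace G t n) : T x = (t : k) ^ n • x := by
    simp only [T, LinearMap.comp_apply, LinearMap.mulLeft_apply, LinearMap.mulRight_apply]
    rw [mem_weightSpace.mp hx, smul_mul_assoc, mul_assoc, hG, mul_one]
  -- The index `none` carries the component `u` of weight `N`; the other indices carry the finitely
  -- many weight vectors of the remainder, whose eigenvalues differ from `t ^ N` because `t` is not
  -- a root of unity.
  have key := sum_filter_eigenvectors_mem T (p := p) hp ((t : k) ^ N) Finset.univ
    (fun a : Option (Fin l) => a.elim u fun i => c i • (g i : R))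
    (fun a => a.elim ((t : k) ^ N) fun i => (t : k) ^ m i)
    (by
      rintro (_ | i) -
      · exact hT hu'
      · exact hT (Submodule.smul_mem _ _ (hmg i)))
    (by simpa [Fintype.sum_option, hg] using hs)
  rw [Finset.sum_filter, Fintype.sum_option] at key
  have hne (i) : (t : k) ^ m i ≠ (t : k) ^ N := fun h => by
    have := zpow_injective_of_pow_ne_one ht h
    have := hm i
    lia
  simpa [hne] using key

end HasLeadingTerm
end Weights
-- The torus and its action on the generators
section Algebra
variable {J L M N : Type*} [Fintype J] [Field L] [CharZero L] [AddCommGroup M] [Module L M]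
  [AddCommGroup N] [Module L N] {P : RootPairing J L M N} [P.IsCrystallographic]
  {k : Type*} [Field k] (b : P.Base) (q : kˣ)

open Uq

/-- The monomials in the `K_α` and `K_α⁻¹`. -/
def torus : Submonoid (Uq b q) :=
  Submonoid.closure (Set.range (K b q) ∪ Set.range (Kinv b q))

theorem Uzero_eq_span : Subalgebra.toSubmodule (Uzero b q) = Submodule.span k (torus b q) :=
  Algebra.adjoin_eq_span k _

variable {b q}

theorem K_mem_torus (i : b.support) : K b q i ∈ torus b q :=
  Submonoid.subset_closure (Or.inl ⟨i, rfl⟩)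

theorem Kinv_mem_torus (i : b.support) : Kinv b q i ∈ torus b q :=
  Submonoid.subset_closure (Or.inr ⟨i, rfl⟩)

theorem torus_le_Uzero {g : Uq b q} (hg : g ∈ torus b q) : g ∈ Uzero b q := by
  rw [← Subalgebra.mem_toSubmodule, Uzero_eq_span]
  exact Submodule.subset_span hg

theorem torus_commute_of {x g : Uq b q} (hK : ∀ i, Commute x (K b q i))
    (hKinv : ∀ i, Commute x (Kinv b q i)) (hg : g ∈ torus b q) : Commute x g := by
  induction hg using Submonoid.closure_induction with
  | mem y hy =>
    rcases hy with ⟨i, rfl⟩ | ⟨i, rfl⟩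
    exacts [hK i, hKinv i]
  | one => exact Commute.one_right x
  | mul y z _ _ hy hz => exact hy.mul_right hz

theorem torus_commute {g h : Uq b q} (hg : g ∈ torus b q) (hh : h ∈ torus b q) :
    Commute g h :=
  torus_commute_of
    (fun i => (torus_commute_of (K_mul_K b q i) (fun j => (Kinv_mul_K_comm b q j i).symm) hg).symm)
    (fun i => (torus_commute_of (Kinv_mul_K_comm b q i) (Kinv_mul_Kinv b q i) hg).symm) hh

theorem exists_inverse_mem_torus {g : Uq b q} (hg : g ∈ torus b q) :
    ∃ g' ∈ torus b q, g * g' = 1 ∧ g' * g = 1 := by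
  induction hg using Submonoid.closure_induction with
  | mem y hy =>
    rcases hy with ⟨i, rfl⟩ | ⟨i, rfl⟩
    · exact ⟨_, Kinv_mem_torus i, K_mul_Kinv b q i, Kinv_mul_K b q i⟩
    · exact ⟨_, K_mem_torus i, Kinv_mul_K b q i, K_mul_Kinv b q i⟩
  | one => exact ⟨1, one_mem _, by simp, by simp⟩
  | mul y z _ _ hy hz =>
    obtain ⟨y', hy', h1, h2⟩ := hy
    obtain ⟨z', hz', h3, h4⟩ := hz
    refine ⟨z' * y', mul_mem hz' hy', ?_, ?_⟩
    · rw [mul_assoc, ← mul_assoc z, h3, one_mul, h1]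
    · rw [mul_assoc, ← mul_assoc y', h2, one_mul, h4]

theorem mem_of_torus_mul_mem {C : Subalgebra k (Uq b q)} (hC : Uzero b q ≤ C) {g x : Uq b q}
    (hg : g ∈ torus b q) (h : g * x ∈ C) : x ∈ C := by
  obtain ⟨g', hg', -, h2⟩ := exists_inverse_mem_torus hg
  have := mul_mem (hC (torus_le_Uzero hg')) h
  rwa [← mul_assoc, h2, one_mul] at this

theorem mem_of_mul_torus_mem {C : Subalgebra k (Uq b q)} (hC : Uzero b q ≤ C) {g x : Uq b q}
    (hg : g ∈ torus b q) (h : x * g ∈ C) : x ∈ C := by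
  obtain ⟨g', hg', h1, -⟩ := exists_inverse_mem_torus hg
  have := mul_mem h (hC (torus_le_Uzero hg'))
  rwa [mul_assoc, h1, mul_one] at this

theorem torus_scale {x : Uq b q} (hK : ∀ j, ∃ c : k, K b q j * x = c • (x * K b q j))
    (hKinv : ∀ j, ∃ c : k, Kinv b q j * x = c • (x * Kinv b q j)) {g : Uq b q}
    (hg : g ∈ torus b q) : ∃ c : k, g * x = c • (x * g) := by
  induction hg using Submonoid.closure_induction with
  | mem y hy =>
    rcases hy with ⟨i, rfl⟩ | ⟨i, rfl⟩
    exacts [hK i, hKinv i]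
  | one => exact ⟨1, by simp⟩
  | mul y z _ _ hy hz =>
    obtain ⟨c, hc⟩ := hy
    obtain ⟨d, hd⟩ := hz
    exact ⟨d * c, by
      rw [mul_assoc, hd, mul_smul_comm, ← mul_assoc, hc, smul_mul_assoc, smul_smul, mul_assoc]⟩

/-- `g` multiplies each `E_α` by `t ^ d_α`, and each `F_α` by `t ^ (-d_α)`, under conjugation. -/
def ActsByWeight (g : Uq b q) (t : kˣ) (d : b.support → ℤ) : Prop :=
  ∀ i, E b q i ∈ weightSpace g t (d i) ∧ F b q i ∈ weightSpace g t (-d i)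

theorem K_actsByWeight (i : b.support) :
    ActsByWeight (K b q i) q fun j => normForm P i j :=
  fun j => ⟨K_mul_E b q i j, K_mul_F b q i j⟩

theorem ActsByWeight.inverse {g g' : Uq b q} {t : kˣ} {d : b.support → ℤ}
    (h : ActsByWeight g t d) (h1 : g' * g = 1) (h2 : g * g' = 1) :
    ActsByWeight g' t (-d) :=
  fun i => ⟨weightSpace_of_inverse h1 h2 (h i).1, weightSpace_of_inverse h1 h2 (h i).2⟩

theorem ActsByWeight.mul {g h : Uq b q} {t : kˣ} {d e : b.support → ℤ}
    (hg : ActsByWeight g t d) (hh : ActsByWeight h t e) : ActsByWeight (g * h) t (d + e) := by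
  have key {x : Uq b q} {m n : ℤ} (h1 : x ∈ weightSpace g t m) (h2 : x ∈ weightSpace h t n) :
      x ∈ weightSpace (g * h) t (m + n) := by
    rw [mem_weightSpace] at *
    rw [mul_assoc, h2, mul_smul_comm, ← mul_assoc, h1, smul_mul_assoc, smul_smul, mul_assoc,
      zpow_add₀ t.ne_zero, mul_comm]
  intro i
  refine ⟨key (hg i).1 (hh i).1, ?_⟩
  have := key (hg i).2 (hh i).2
  rwa [Pi.add_apply, neg_add]

theorem exists_actsByWeight (μ : b.support → ℤ) :
    ∃ g ∈ torus b q, ActsByWeight g q fun i => ∑ j, μ j * normForm P j i := by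
  classical
  -- The exponent vectors realised by torus elements form a subgroup, and `K_j` realises the `j`-th
  -- unit vector.
  let S : AddSubgroup (b.support → ℤ) :=
    { carrier := {μ | ∃ g ∈ torus b q, ActsByWeight g q fun i => ∑ j, μ j * normForm P j i}
      zero_mem' := ⟨1, one_mem _, fun i => by simp [mem_weightSpace]⟩
      add_mem' := by
        rintro μ ν ⟨g, hg, h1⟩ ⟨h, hh, h2⟩
        refine ⟨g * h, mul_mem hg hh, ?_⟩
        convert h1.mul h2 using 1
        ext i
        simp [add_mul, Finset.sum_add_distrib]
      neg_mem' := by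
        rintro μ ⟨g, hg, h1⟩
        obtain ⟨g', hg', h2, h3⟩ := exists_inverse_mem_torus hg
        refine ⟨g', hg', ?_⟩
        convert h1.inverse h3 h2 using 1
        ext i
        simp }
  have hsingle (j : b.support) : Pi.single j 1 ∈ S := by
    refine ⟨K b q j, K_mem_torus j, ?_⟩
    convert K_actsByWeight (q := q) j using 1
    ext i
    simp [Pi.single_apply]
  have : μ = ∑ j, μ j • (Pi.single j 1 : b.support → ℤ) := by
    ext i
    simp [Finset.sum_apply, Pi.single_apply]
  change μ ∈ S
  rw [this]
  exact sum_mem fun j _ => zsmul_mem (hsingle j) _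

/-! ### Nondegeneracy of the form and the height grading -/

section Nondegenerate
variable [P.IsReduced]

/-- Multiplying row `i` by `shortLength P i` replaces `normForm` by twice the canonical form,
whatever the normalization on each component. That form is positive definite on the root lattice, so
`∑ xⱼ αⱼ = 0`, and the simple roots are independent. -/
theorem eq_zero_of_sum_normForm_eq_zero (x : b.support → ℤ)
    (h : ∀ i : b.support, ∑ j : b.support, normForm P i j * x j = 0) : x = 0 := by
  let y : P.rootSpan ℤ := ∑ j : b.support, x j • P.rootSpanMem ℤ j
  have h1 (i : b.support) : (P.posRootForm ℤ).posForm (P.rootSpanMem ℤ i) y = 0 := by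
    have h2 : 2 * (P.posRootForm ℤ).posForm (P.rootSpanMem ℤ i) y = 0 := by
      have := congrArg (· * shortLength P (i : J)) (h i)
      simp only [Finset.sum_mul, zero_mul] at this
      rw [map_sum, Finset.mul_sum, ← this]
      refine Finset.sum_congr rfl fun j _ => ?_
      rw [map_smul, smul_eq_mul]
      linear_combination -x j * normForm_mul_shortLength (P := P) i j
    lia
  have h3 : (P.posRootForm ℤ).posForm y y = 0 := by
    change (P.posRootForm ℤ).posForm.flip y (∑ j : b.support, x j • P.rootSpanMem ℤ j) = 0
    rw [map_sum]
    refine Finset.sum_eq_zero fun j _ => ?_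
    rw [map_smul]
    exact smul_eq_zero_of_right _ (h1 j)
  have h4 : y = 0 := by
    by_contra hne
    exact (P.posRootForm_posForm_pos_of_ne_zero ℤ hne).ne' h3
  have h5 : ∑ j : b.support, (x j : L) • P.root j = 0 := by
    have := congrArg (Subtype.val) h4
    simp only [y, AddSubmonoidClass.coe_finsetSum] at this
    rw [← ZeroMemClass.coe_zero (P.rootSpan ℤ), ← this]
    refine Finset.sum_congr rfl fun j _ => ?_
    rw [Int.cast_smul_eq_zsmul]
    rfl
  have h6 := Fintype.linearIndependent_iff.mp b.linearIndepOn_root (fun j => (x j : L)) h5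
  ext j
  simpa using h6 j

/-- Conjugation by a suitable torus element gives the grading by height, up to a factor. -/
theorem exists_height_element (hq : ∀ n : ℕ, 0 < n → (q : k) ^ n ≠ 1) :
    ∃ t : kˣ, (∀ n : ℕ, 0 < n → (t : k) ^ n ≠ 1) ∧
      ∃ g ∈ torus b q, ActsByWeight g t fun _ => 1 := by
  classical
  let A : Matrix b.support b.support ℤ := .of fun i j => normForm P i j
  have hA : A.det ≠ 0 := by
    rw [Ne, ← Matrix.exists_mulVec_eq_zero_iff]
    rintro ⟨x, hx, h⟩
    exact hx (eq_zero_of_sum_normForm_eq_zero x fun i => congrFun h i)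
  -- The integral vector `μ = det A · (1, …, 1) · adj A` satisfies `μ A = (det A)² (1, …, 1)`. The
  -- extra factor `det A` makes the common weight positive, so that `t = q ^ m` with `m = (det A)²`.
  obtain ⟨g, hg, h⟩ := exists_actsByWeight (q := q)
    (Matrix.vecMul (fun _ => A.det) A.adjugate)
  have hd (i : b.support) : ∑ j, Matrix.vecMul (fun _ => A.det) A.adjugate j * normForm P j i
      = A.det ^ 2 := by
    have : Matrix.vecMul (Matrix.vecMul (fun _ => A.det) A.adjugate) A i = A.det ^ 2 := by
      rw [Matrix.vecMul_vecMul, Matrix.adjugate_mul, Matrix.vecMul_smul, Matrix.vecMul_one]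
      simp [sq]
    exact this
  obtain ⟨m, hm⟩ : ∃ m : ℕ, A.det ^ 2 = m := ⟨(A.det ^ 2).toNat, by have := sq_nonneg A.det; lia⟩
  have hm0 : 0 < m := by
    have : A.det ^ 2 ≠ 0 := pow_ne_zero 2 hA
    lia
  refine ⟨q ^ m, fun n hn => ?_, g, hg, fun i => ?_⟩
  · rw [Units.val_pow_eq_pow_val, ← pow_mul]
    exact hq _ (Nat.mul_pos hm0 hn)
  · have h1 := h i
    simp only [hd, hm, mem_weightSpace] at h1
    simpa [mem_weightSpace] using h1

/-- Two words with the same weight differ by a permutation. -/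
theorem perm_of_sum_normForm_eq {w w' : List b.support}
    (h : ∀ i : b.support, (w.map fun j : b.support => normForm P i j).sum
      = (w'.map fun j : b.support => normForm P i j).sum) :
    w.Perm w' := by
  classical
  have hsum (i : b.support) (w : List b.support) :
      (w.map fun j : b.support => normForm P i j).sum
        = ∑ j : b.support, normForm P i j * (w.count j : ℤ) := by
    induction w with
    | nil => simp
    | cons l w ih =>
      rw [List.map_cons, List.sum_cons, ih]
      simp [List.count_cons, mul_add, Finset.sum_add_distrib, add_comm]
  have h0 := eq_zero_of_sum_normForm_eq_zero (fun j => (w.count j : ℤ) - w'.count j) fun i => by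
    simp only [mul_sub, Finset.sum_sub_distrib, ← hsum, h, sub_self]
  rw [List.perm_iff_count]
  intro j
  have := congrFun h0 j
  simp only [Pi.zero_apply] at this
  lia

end Nondegenerate
end Algebra
-- Leading terms of coproducts and linear independence
section Algebra
variable {J L M N : Type*} [Fintype J] [Field L] [CharZero L] [AddCommGroup M] [Module L M]
  [AddCommGroup N] [Module L N] {P : RootPairing J L M N} [P.IsCrystallographic]
  {k : Type*} [Field k] (b : P.Base) (q : kˣ)

open Uq

/-- The elements `F_α K_α`, whose coproduct has the same shape as that of `E_α`. -/
def FK (i : b.support) : Uq b q := F b q i * K b q i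

variable {b q}

theorem FK_mem_weightSpace {g : Uq b q} {t : kˣ} {d : b.support → ℤ} (h : ActsByWeight g t d)
    (hg : g ∈ torus b q) (i : b.support) : FK b q i ∈ weightSpace g t (-d i) := by
  have hK : K b q i ∈ weightSpace g t 0 := by
    simpa [mem_weightSpace] using (torus_commute hg (K_mem_torus i)).eq
  simpa [FK] using weightSpace_mul (h i).2 hK

theorem linearIndependent_mul_unit {κ : Type*} {x : κ → Uq b q} (hx : LinearIndependent k x)
    {h : Uq b q} (hh : h ∈ torus b q) : LinearIndependent k fun j => x j * h := by
  obtain ⟨h', -, h1, -⟩ := exists_inverse_mem_torus hh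
  refine hx.map' (LinearMap.mulRight k h) (LinearMap.ker_eq_bot.mpr fun y z hyz => ?_)
  simpa [mul_assoc, h1] using congrArg (· * h') hyz

theorem linearIndependent_unit_mul {κ : Type*} {x : κ → Uq b q} (hx : LinearIndependent k x)
    {h : Uq b q} (hh : h ∈ torus b q) : LinearIndependent k fun j => h * x j := by
  obtain ⟨h', -, -, h2⟩ := exists_inverse_mem_torus hh
  refine hx.map' (LinearMap.mulLeft k h) (LinearMap.ker_eq_bot.mpr fun y z hyz => ?_)
  simpa [← mul_assoc, h2] using congrArg (h' * ·) hyz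

theorem linearIndepOn_fiber_snd {κ ι V : Type*} [AddCommGroup V] [Module k V] {x : κ × ι → V}
    (i : ι) (h : LinearIndependent k fun j => x (j, i)) :
    LinearIndepOn k x {p | p.2 = i} := by
  have h1 := h.comp (fun p : {p : κ × ι | p.2 = i} => p.1.1) fun p p' hp =>
    Subtype.ext (Prod.ext hp (p.2.trans p'.2.symm))
  have h2 : ((fun j => x (j, i)) ∘ fun p : {p : κ × ι | p.2 = i} => p.1.1)
      = fun p : {p : κ × ι | p.2 = i} => x p := by
    funext p
    obtain ⟨⟨j, _⟩, rfl⟩ := p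
    rfl
  rwa [h2] at h1

variable [P.IsReduced]

theorem comulHom_FK (i : b.support) :
    comulHom b q (FK b q i) = FK b q i ⊗ₜ 1 + K b q i ⊗ₜ FK b q i := by
  rw [FK, map_mul, comulHom_F, comulHom_K]
  simp [add_mul, Kinv_mul_K]

theorem comulHom_torus {g : Uq b q} (hg : g ∈ torus b q) : comulHom b q g = g ⊗ₜ g := by
  induction hg using Submonoid.closure_induction with
  | mem y hy =>
    rcases hy with ⟨i, rfl⟩ | ⟨i, rfl⟩
    exacts [comulHom_K b q i, comulHom_Kinv b q i]
  | one => rw [map_one, Algebra.TensorProduct.one_def]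
  | mul y z _ _ hy hz => rw [map_mul, hy, hz, Algebra.TensorProduct.tmul_mul_tmul]

/-- Torus monomials are group-like, and distinct group-like elements are linearly independent. -/
theorem linearIndependent_torus : LinearIndependent k fun g : torus b q => (g : Uq b q) := by
  have h : ∀ g ∈ torus b q, IsGroupLikeElem k g := by
    intro g hg
    induction hg using Submonoid.closure_induction with
    | mem y hy =>
      rcases hy with ⟨i, rfl⟩ | ⟨i, rfl⟩
      · exact ⟨counitHom_K b q i, comulHom_K b q i⟩
      · exact ⟨counitHom_Kinv b q i, comulHom_Kinv b q i⟩
    | one => exact .one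
    | mul y z _ _ hy hz => exact hy.mul hz
  exact linearIndepOn_isGroupLikeElem.mono (t := (torus b q : Set (Uq b q))) h

section LeadingTerms
variable {g : Uq b q} {t : kˣ}

theorem torus_hasLeadingTerm (hg : g ∈ torus b q) {h : Uq b q} (hh : h ∈ torus b q) :
    HasLeadingTerm ((1 : Uq b q) ⊗ₜ[k] g) t (comulHom b q h) 0 (h ⊗ₜ h) := by
  rw [comulHom_torus hh]
  refine .of_mem (tmul_mem_weightSpace ?_ h)
  simpa [mem_weightSpace] using (torus_commute hg hh).eq

theorem prod_map_tmul {R I : Type*} [Ring R] [Algebra k R] (x y : I → R) (w : List I) :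
    (w.map fun i => x i ⊗ₜ[k] y i).prod = (w.map x).prod ⊗ₜ (w.map y).prod := by
  induction w with
  | nil => rfl
  | cons i w ih => simp [ih]

theorem one_mem_weightSpace {R : Type*} [Ring R] [Algebra k R] (g : R) :
    (1 : R) ∈ weightSpace g t 0 := by
  simp [mem_weightSpace]

/-- In `X ⊗ 1 + K ⊗ X` the second factors have weights `0` and `1`, so the top of the product takes
`K ⊗ X` from every letter. Applied to both `E` and `FK`, depending on whether weights are taken for
`g` or for its inverse. -/
theorem skew_hasLeadingTerm_pos {X : b.support → Uq b q}
    (hΔ : ∀ i, comulHom b q (X i) = X i ⊗ₜ 1 + K b q i ⊗ₜ X i)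
    (hX : ∀ i, X i ∈ weightSpace g t 1) (w : List b.support) :
    HasLeadingTerm ((1 : Uq b q) ⊗ₜ[k] g) t (comulHom b q (w.map X).prod) w.length
      ((w.map (K b q)).prod ⊗ₜ (w.map X).prod) := by
  have h (i) : HasLeadingTerm ((1 : Uq b q) ⊗ₜ[k] g) t (comulHom b q (X i)) 1
      (K b q i ⊗ₜ X i) := by
    rw [hΔ, add_comm]
    exact .add_of_mem (tmul_mem_weightSpace (hX i) _)
      (tmul_mem_weightSpace (one_mem_weightSpace g) _) one_pos
  have := HasLeadingTerm.list_prod h w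
  rw [prod_map_tmul, mul_one] at this
  rwa [map_list_prod, List.map_map]

/-- With weights `0` and `-1` it is now `X ⊗ 1` that dominates. The second factor `1` keeps no trace
of the word; for `F` it would be a product of `K_α⁻¹`, which would mix with the torus part of a
monomial. This is the reason for working with `FK`. -/
theorem skew_hasLeadingTerm_neg {X : b.support → Uq b q}
    (hΔ : ∀ i, comulHom b q (X i) = X i ⊗ₜ 1 + K b q i ⊗ₜ X i)
    (hX : ∀ i, X i ∈ weightSpace g t (-1)) (w : List b.support) :
    HasLeadingTerm ((1 : Uq b q) ⊗ₜ[k] g) t (comulHom b q (w.map X).prod) 0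
      ((w.map X).prod ⊗ₜ 1) := by
  have h (i) : HasLeadingTerm ((1 : Uq b q) ⊗ₜ[k] g) t (comulHom b q (X i)) 0
      (X i ⊗ₜ 1) := by
    rw [hΔ]
    exact .add_of_mem (tmul_mem_weightSpace (one_mem_weightSpace g) _)
      (tmul_mem_weightSpace (hX i) _) (by simp)
  have := HasLeadingTerm.list_prod h w
  rw [prod_map_tmul, mul_zero] at this
  rw [map_list_prod, List.map_map]
  simpa [Function.comp_def] using this

theorem F_hasLeadingTerm (hg : g ∈ torus b q) (hF : ∀ i, F b q i ∈ weightSpace g t 1)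
    (w : List b.support) :
    HasLeadingTerm ((1 : Uq b q) ⊗ₜ[k] g) t (comulHom b q (w.map (F b q)).prod) w.length
      (1 ⊗ₜ (w.map (F b q)).prod) := by
  have h (i) : HasLeadingTerm ((1 : Uq b q) ⊗ₜ[k] g) t (comulHom b q (F b q i)) 1
      (1 ⊗ₜ F b q i) := by
    rw [comulHom_F, add_comm]
    refine .add_of_mem (tmul_mem_weightSpace (hF i) _) (m := 0) (tmul_mem_weightSpace ?_ _) one_pos
    simpa [mem_weightSpace] using (torus_commute hg (Kinv_mem_torus i)).eq
  have := HasLeadingTerm.list_prod h w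
  rw [prod_map_tmul, mul_one] at this
  rw [map_list_prod, List.map_map]
  simpa [Function.comp_def] using this

variable {g' : Uq b q}

/-- The leading term of an element of a right coideal lies in the right coideal. -/
theorem sum_leadingTerm_mem (h : g * g' = 1) (ht : ∀ n : ℕ, 0 < n → (t : k) ^ n ≠ 1)
    {V : Submodule k (Uq b q)}
    (hV : ∀ c ∈ V, comulHom b q c ∈ LinearMap.range (LinearMap.rTensor (Uq b q) V.subtype))
    {σ : Type*} {s : Finset σ} {f : σ → k} {m : σ → Uq b q} {n : σ → ℤ}
    {z : σ → Uq b q ⊗[k] Uq b q}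
    (hm : ∀ a ∈ s, HasLeadingTerm ((1 : Uq b q) ⊗ₜ[k] g) t (comulHom b q (m a)) (n a) (z a))
    {d : ℤ} (hd : ∀ a ∈ s, n a ≤ d) (hs : ∑ a ∈ s, f a • m a ∈ V) :
    ∑ a ∈ s with n a = d, f a • z a
      ∈ LinearMap.range (LinearMap.rTensor (Uq b q) V.subtype) := by
  refine HasLeadingTerm.sum_filter_mem (G' := (1 : Uq b q) ⊗ₜ[k] g')
    (by simp [h, Algebra.TensorProduct.one_def]) ht ?_ hm hd ?_
  -- Conjugation by `1 ⊗ g` acts on the second factor only, hence preserves `V ⊗ U`.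
  · rintro _ ⟨z, rfl⟩
    refine ⟨LinearMap.lTensor V (LinearMap.mulRight k g' ∘ₗ LinearMap.mulLeft k g) z, ?_⟩
    induction z with
    | zero => simp
    | add x y hx hy => simp only [map_add, hx, hy, mul_add, add_mul]
    | tmul x y => simp
  · simpa using hV _ hs

/-- In a nontrivial relation, the terms of maximal degree with nonzero coefficient give a relation
between their leading terms: this is `sum_leadingTerm_mem` for the right coideal `V = ⊥`. -/
theorem linearIndependent_of_leadingTerm (h : g * g' = 1)
    (ht : ∀ n : ℕ, 0 < n → (t : k) ^ n ≠ 1)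
    {σ : Type*} {m : σ → Uq b q} {n : σ → ℤ} {z : σ → Uq b q ⊗[k] Uq b q}
    (hm : ∀ a, HasLeadingTerm ((1 : Uq b q) ⊗ₜ[k] g) t (comulHom b q (m a)) (n a) (z a))
    (hz : LinearIndependent k z) : LinearIndependent k m := by
  classical
  rw [linearIndependent_iff']
  intro s f hs a ha
  by_contra hfa
  obtain ⟨a₁, ha₁, hmax⟩ := (s.filter fun a => f a ≠ 0).exists_max_image n ⟨a, by simp [ha, hfa]⟩
  have h1 := sum_leadingTerm_mem h ht (V := ⊥) (f := f) (m := m) (s := s.filter fun a => f a ≠ 0)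
    (fun c hc => by
      rw [(Submodule.mem_bot k).mp hc, map_zero]
      exact Submodule.zero_mem _)
    (fun a _ => hm a) (d := n a₁) hmax
    (by
      rw [Finset.sum_filter_of_ne, hs]
      · exact Submodule.zero_mem _
      · intro a _ h h0
        simp [h0] at h)
  have h2 : LinearMap.rTensor (Uq b q) (⊥ : Submodule k (Uq b q)).subtype = 0 := by
    rw [Subsingleton.elim (⊥ : Submodule k (Uq b q)).subtype 0, LinearMap.rTensor_zero]
  rw [h2, LinearMap.range_zero, Submodule.mem_bot] at h1
  exact (Finset.mem_filter.mp ha₁).2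
    (linearIndependent_iff'.mp hz _ f h1 a₁ (by simpa using ha₁))

variable {κ : Type*} {a : κ → List b.support} {X : b.support → Uq b q}

/-- The leading term of `X_v h` is `X_v h ⊗ h`. The elements `h` are independent, and for fixed `h`
right multiplication by this unit preserves the independence of the `X_v`. -/
theorem linearIndependent_skew_mul_torus (hg : g ∈ torus b q) (h : g * g' = 1)
    (ht : ∀ n : ℕ, 0 < n → (t : k) ^ n ≠ 1)
    (hΔ : ∀ i, comulHom b q (X i) = X i ⊗ₜ 1 + K b q i ⊗ₜ X i)
    (hX : ∀ i, X i ∈ weightSpace g t (-1))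
    (ha : LinearIndependent k fun j => ((a j).map X).prod) :
    LinearIndependent k fun p : κ × torus b q => ((a p.1).map X).prod * (p.2 : Uq b q) := by
  refine linearIndependent_of_leadingTerm h ht (n := fun _ => 0)
    (z := fun p => (((a p.1).map X).prod * (p.2 : Uq b q)) ⊗ₜ (p.2 : Uq b q)) (fun p => ?_)
    (linearIndependent_tmul (π := fun p : κ × torus b q => p.2) linearIndependent_torus fun i => ?_)
  · have := (skew_hasLeadingTerm_neg hΔ hX (a p.1)).mul (torus_hasLeadingTerm hg p.2.2)
    rwa [← map_mul, Algebra.TensorProduct.tmul_mul_tmul, one_mul, add_zero] at this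
  · have h1 := linearIndependent_mul_unit ha i.2
    exact linearIndepOn_fiber_snd
      (x := fun p : κ × torus b q => ((a p.1).map X).prod * (p.2 : Uq b q)) i h1

theorem linearIndependent_torus_mul_skew (hg : g ∈ torus b q) (h : g * g' = 1)
    (ht : ∀ n : ℕ, 0 < n → (t : k) ^ n ≠ 1)
    (hΔ : ∀ i, comulHom b q (X i) = X i ⊗ₜ 1 + K b q i ⊗ₜ X i)
    (hX : ∀ i, X i ∈ weightSpace g t (-1))
    (ha : LinearIndependent k fun j => ((a j).map X).prod) :
    LinearIndependent k fun p : κ × torus b q => (p.2 : Uq b q) * ((a p.1).map X).prod := by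
  refine linearIndependent_of_leadingTerm h ht (n := fun _ => 0)
    (z := fun p => ((p.2 : Uq b q) * ((a p.1).map X).prod) ⊗ₜ (p.2 : Uq b q)) (fun p => ?_)
    (linearIndependent_tmul (π := fun p : κ × torus b q => p.2) linearIndependent_torus fun i => ?_)
  · have := (torus_hasLeadingTerm hg p.2.2).mul (skew_hasLeadingTerm_neg hΔ hX (a p.1))
    rwa [← map_mul, Algebra.TensorProduct.tmul_mul_tmul, mul_one, add_zero] at this
  · have h1 := linearIndependent_unit_mul ha i.2
    exact linearIndepOn_fiber_snd
      (x := fun p : κ × torus b q => (p.2 : Uq b q) * ((a p.1).map X).prod) i h1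

/-- The leading term of `F_v h` is `h ⊗ F_v h`; here the first factors separate the torus elements.
-/
theorem linearIndependent_F_mul_torus (hg : g ∈ torus b q) (h : g * g' = 1)
    (ht : ∀ n : ℕ, 0 < n → (t : k) ^ n ≠ 1) (hF : ∀ i, F b q i ∈ weightSpace g t 1)
    (ha : LinearIndependent k fun j => ((a j).map (F b q)).prod) :
    LinearIndependent k fun p : κ × torus b q => ((a p.1).map (F b q)).prod * (p.2 : Uq b q) := by
  refine linearIndependent_of_leadingTerm h ht (n := fun p => (a p.1).length)
    (z := fun p => (p.2 : Uq b q) ⊗ₜ (((a p.1).map (F b q)).prod * (p.2 : Uq b q))) (fun p => ?_)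
    (linearIndependent_tmul' (π := fun p : κ × torus b q => p.2) linearIndependent_torus fun i => ?_)
  · have := (F_hasLeadingTerm hg hF (a p.1)).mul (torus_hasLeadingTerm hg p.2.2)
    rwa [← map_mul, Algebra.TensorProduct.tmul_mul_tmul, one_mul, add_zero] at this
  · have h1 := linearIndependent_mul_unit ha i.2
    exact linearIndepOn_fiber_snd
      (x := fun p : κ × torus b q => ((a p.1).map (F b q)).prod * (p.2 : Uq b q)) i h1

/-- Linear independence of the monomials `F_v K E_w`, where `F_v` and `E_w` run over linearly
independent families. -/
theorem linearIndependent_F_mul_torus_mul_E (hg : g ∈ torus b q) (h : g * g' = 1)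
    (ht : ∀ n : ℕ, 0 < n → (t : k) ^ n ≠ 1) (hF : ∀ i, F b q i ∈ weightSpace g t 1)
    (hE : ∀ i, E b q i ∈ weightSpace g t (-1))
    (ha : LinearIndependent k fun j => ((a j).map (F b q)).prod)
    {κ' : Type*} {a' : κ' → List b.support}
    (ha' : LinearIndependent k fun j => ((a' j).map (E b q)).prod) :
    LinearIndependent k fun p : κ' × (κ × torus b q) =>
      ((a p.2.1).map (F b q)).prod * (p.2.2 : Uq b q) * ((a' p.1).map (E b q)).prod := by
  -- The leading term of `F_v h E_w` is `h E_w ⊗ F_v h`: the second factors separate the pairs `(v,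
  -- h)`, and for a fixed pair the elements `h E_w` are independent.
  refine linearIndependent_of_leadingTerm h ht (n := fun p => (a p.2.1).length)
    (z := fun p => ((p.2.2 : Uq b q) * ((a' p.1).map (E b q)).prod) ⊗ₜ
      (((a p.2.1).map (F b q)).prod * (p.2.2 : Uq b q))) (fun p => ?_)
    (linearIndependent_tmul (π := fun p : κ' × (κ × torus b q) => p.2)
      (linearIndependent_F_mul_torus hg h ht hF ha) fun i => ?_)
  · have := ((F_hasLeadingTerm hg hF (a p.2.1)).mul (torus_hasLeadingTerm hg p.2.2.2)).mul
      (skew_hasLeadingTerm_neg (comulHom_E b q) hE (a' p.1))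
    rwa [← map_mul, ← map_mul, Algebra.TensorProduct.tmul_mul_tmul,
      Algebra.TensorProduct.tmul_mul_tmul, one_mul, mul_one, add_zero, add_zero] at this
  · have h1 := linearIndependent_unit_mul ha' i.2.2
    exact linearIndepOn_fiber_snd (x := fun p : κ' × (κ × torus b q) =>
      (p.2.2 : Uq b q) * ((a' p.1).map (E b q)).prod) i h1

end LeadingTerms
end Algebra
-- Spanning by ordered monomials
section Algebra
variable {J L M N : Type*} [Fintype J] [Field L] [CharZero L] [AddCommGroup M] [Module L M]
  [AddCommGroup N] [Module L N] {P : RootPairing J L M N} [P.IsCrystallographic]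
  {k : Type*} [Field k] (b : P.Base) (q : kˣ)

open Uq

theorem adjoin_range_eq_span {R I : Type*} [Ring R] [Algebra k R] (X : I → R) :
    Subalgebra.toSubmodule (Algebra.adjoin k (Set.range X))
      = Submodule.span k (Set.range fun w : List I => (w.map X).prod) := by
  rw [Algebra.adjoin_eq_span]
  congr 1
  ext y
  constructor
  · intro hy
    induction hy using Submonoid.closure_induction with
    | mem y hy =>
      obtain ⟨i, rfl⟩ := hy
      exact ⟨[i], by simp⟩
    | one => exact ⟨[], rfl⟩
    | mul y z _ _ hy hz =>
      obtain ⟨v, rfl⟩ := hy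
      obtain ⟨w, rfl⟩ := hz
      exact ⟨v ++ w, by simp⟩
  · rintro ⟨w, rfl⟩
    refine Submonoid.list_prod_mem _ fun y hy => ?_
    obtain ⟨i, -, rfl⟩ := List.mem_map.mp hy
    exact Submonoid.subset_closure ⟨i, rfl⟩

universe u

/-- Words in the generators span, so some of them form a basis. Having words as basis elements keeps
weights and leading terms explicit. -/
theorem exists_word_basis {R : Type*} {I : Type u} [Ring R] [Algebra k R] (X : I → R) :
    ∃ (κ : Type u) (a : κ → List I), LinearIndependent k (fun j => ((a j).map X).prod) ∧
      Submodule.span k (Set.range fun j => ((a j).map X).prod)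
        = Subalgebra.toSubmodule (Algebra.adjoin k (Set.range X)) := by
  obtain ⟨κ, a, -, h1, h2⟩ := exists_linearIndependent' k fun w : List I => (w.map X).prod
  exact ⟨κ, a, h2, by rw [adjoin_range_eq_span, ← h1]; rfl⟩

/-- The subalgebra generated by all `F_α K_α`. -/
def UFK : Subalgebra k (Uq b q) := Algebra.adjoin k (Set.range (FK b q))

variable {b q}

theorem torus_mul_E {g : Uq b q} (hg : g ∈ torus b q) (i : b.support) :
    ∃ c : k, g * E b q i = c • (E b q i * g) :=
  torus_scale (fun j => ⟨_, K_mul_E b q j i⟩) (fun j => ⟨_, Kinv_mul_E b q j i⟩) hg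

theorem torus_mul_F {g : Uq b q} (hg : g ∈ torus b q) (i : b.support) :
    ∃ c : k, g * F b q i = c • (F b q i * g) :=
  torus_scale (fun j => ⟨_, K_mul_F b q j i⟩) (fun j => ⟨_, Kinv_mul_F b q j i⟩) hg

theorem mul_list_prod_scale {R I : Type*} [Ring R] [Algebra k R] {X : I → R} {g : R}
    (h : ∀ i, ∃ c : k, g * X i = c • (X i * g)) (w : List I) :
    ∃ c : k, g * (w.map X).prod = c • ((w.map X).prod * g) := by
  induction w with
  | nil => exact ⟨1, by simp⟩
  | cons i w ih =>
    obtain ⟨c, hc⟩ := h i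
    obtain ⟨d, hd⟩ := ih
    refine ⟨c * d, ?_⟩
    rw [List.map_cons, List.prod_cons, ← mul_assoc, hc, smul_mul_assoc, mul_assoc, hd,
      mul_smul_comm, smul_smul, mul_assoc]

theorem torus_mul_FK {g : Uq b q} (hg : g ∈ torus b q) (i : b.support) :
    ∃ c : k, g * FK b q i = c • (FK b q i * g) := by
  obtain ⟨c, hc⟩ := torus_mul_F hg i
  refine ⟨c, ?_⟩
  rw [FK, ← mul_assoc, hc, smul_mul_assoc, mul_assoc, (torus_commute hg (K_mem_torus i)).eq,
    mul_assoc]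

theorem E_mul_FK (i j : b.support) :
    ∃ c : k, ∃ z ∈ Uzero b q, E b q i * FK b q j = c • (FK b q j * E b q i) + z := by
  have h1 : ∃ z ∈ Uzero b q, E b q i * F b q j = F b q j * E b q i + z := by
    refine ⟨E b q i * F b q j - F b q j * E b q i, ?_, by abel⟩
    by_cases hij : i = j
    · subst hij
      rw [E_mul_F_self]
      exact Subalgebra.smul_mem _ (sub_mem (torus_le_Uzero (K_mem_torus i))
        (torus_le_Uzero (Kinv_mem_torus i))) _
    · rw [E_mul_F_of_ne b q hij]
      exact zero_mem _
  obtain ⟨z, hz, h1⟩ := h1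
  refine ⟨((q : k) ^ normForm P j i)⁻¹, z * K b q j,
    mul_mem hz (torus_le_Uzero (K_mem_torus j)), ?_⟩
  rw [FK, ← mul_assoc, h1, add_mul, mul_assoc _ (K b q j), K_mul_E, mul_smul_comm, smul_smul,
    inv_mul_cancel₀ (zpow_ne_zero _ q.ne_zero), one_smul, mul_assoc]

/-- The product space contains `1` and is stable under left multiplication by every generator: torus
elements pass the `F_α K_α` up to scalars, and moving `E_α` to the right past `F_β K_β` costs a
scalar and a torus term, which is absorbed in the middle factor. -/
theorem FK_mul_Uzero_mul_E_eq_top :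
    Subalgebra.toSubmodule (UFK b q) * (Subalgebra.toSubmodule (Uzero b q)
      * Subalgebra.toSubmodule (Upos b q)) = ⊤ := by
  set A := Subalgebra.toSubmodule (UFK b q) with hA
  set Z := Subalgebra.toSubmodule (Uzero b q) with hZ
  set B := Subalgebra.toSubmodule (Upos b q) with hB
  have hAA : A * A = A := (Subalgebra.isIdempotentElem_toSubmodule _).eq
  have hZZ : Z * Z = Z := (Subalgebra.isIdempotentElem_toSubmodule _).eq
  have hBB : B * B = B := (Subalgebra.isIdempotentElem_toSubmodule _).eq
  have hAs : A = Submodule.span k (Set.range fun w : List b.support => (w.map (FK b q)).prod) :=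
    adjoin_range_eq_span _
  have hFK (i) : FK b q i ∈ A := Algebra.subset_adjoin ⟨i, rfl⟩
  have hE (i) : Submodule.span k {E b q i} ≤ B := by
    rw [Submodule.span_singleton_le_iff_mem]
    exact Algebra.subset_adjoin ⟨i, rfl⟩
  have hZA : Z * A ≤ A * Z := by
    rw [hZ, Uzero_eq_span, hAs, Submodule.span_mul_span, Submodule.span_le]
    rintro _ ⟨g, hg, _, ⟨w, rfl⟩, rfl⟩
    obtain ⟨c, hc⟩ := mul_list_prod_scale (torus_mul_FK hg) w
    simp only [hc]
    exact Submodule.smul_mem _ _ (Submodule.mul_mem_mul (Submodule.subset_span ⟨w, rfl⟩)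
      (Submodule.subset_span hg))
  have hEZ (i) : Submodule.span k {E b q i} * Z ≤ Z * Submodule.span k {E b q i} := by
    rw [hZ, Uzero_eq_span, Submodule.span_mul_span, Submodule.span_le]
    rintro _ ⟨_, rfl, g, hg, rfl⟩
    obtain ⟨g', hg', h1, h2⟩ := exists_inverse_mem_torus hg
    obtain ⟨c, hc⟩ := torus_mul_E hg' i
    have h3 : E b q i * g = c • (g * E b q i) := by
      rw [← one_mul (E b q i * g), ← h1, mul_assoc, ← mul_assoc g', hc, smul_mul_assoc, mul_assoc,
        h2, mul_one, mul_smul_comm]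
    simp only [h3]
    exact Submodule.smul_mem _ _ (Submodule.mul_mem_mul (Submodule.subset_span hg)
      (Submodule.mem_span_singleton_self _))
  -- Induction on the word in `A`: either `E` survives to the far right, or it has been traded for
  -- an element of `U⁰`, which is then moved to the right of `A` by `hZA`.
  have hEA (i) : Submodule.span k {E b q i} * A ≤ A * Z ⊔ A * Submodule.span k {E b q i} := by
    have hAT : A * (A * Z ⊔ A * Submodule.span k {E b q i})
        = A * Z ⊔ A * Submodule.span k {E b q i} := by
      rw [Submodule.mul_sup, ← mul_assoc, ← mul_assoc, hAA]
    conv_lhs => rw [hAs]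
    rw [Submodule.span_mul_span, Submodule.span_le]
    rintro _ ⟨_, rfl, _, ⟨w, rfl⟩, rfl⟩
    have hw (w : List b.support) : (w.map (FK b q)).prod ∈ A := by
      rw [hAs]
      exact Submodule.subset_span ⟨w, rfl⟩
    simp only [SetLike.mem_coe]
    induction w with
    | nil =>
      refine Submodule.mem_sup_right ?_
      simpa using Submodule.mul_mem_mul (show (1 : Uq b q) ∈ A from one_mem (UFK b q))
        (Submodule.mem_span_singleton_self (R := k) (E b q i))
    | cons j w ih =>
      obtain ⟨c, z, hz, h⟩ := E_mul_FK (q := q) i j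
      rw [List.map_cons, List.prod_cons, ← mul_assoc, h, add_mul, smul_mul_assoc, mul_assoc]
      refine add_mem (Submodule.smul_mem _ _ ?_) (Submodule.mem_sup_left (hZA ?_))
      · rw [← hAT]
        exact Submodule.mul_mem_mul (hFK j) ih
      · exact Submodule.mul_mem_mul hz (hw w)
  have hZS : Z * (A * (Z * B)) ≤ A * (Z * B) := by
    calc Z * (A * (Z * B)) = (Z * A) * (Z * B) := (mul_assoc _ _ _).symm
      _ ≤ (A * Z) * (Z * B) := mul_le_mul' hZA le_rfl
      _ = A * (Z * B) := by rw [mul_assoc, ← mul_assoc Z, hZZ]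
  have hAS : A * (A * (Z * B)) ≤ A * (Z * B) := by rw [← mul_assoc, hAA]
  have hES (i) : Submodule.span k {E b q i} * (A * (Z * B)) ≤ A * (Z * B) := by
    rw [← mul_assoc]
    refine (mul_le_mul' (hEA i) le_rfl).trans ?_
    rw [Submodule.sup_mul]
    refine sup_le ?_ ?_
    · rw [mul_assoc, ← mul_assoc Z, hZZ]
    · calc A * Submodule.span k {E b q i} * (Z * B)
          = A * ((Submodule.span k {E b q i} * Z) * B) := by simp only [mul_assoc]
        _ ≤ A * ((Z * B) * B) :=
            mul_le_mul' le_rfl (mul_le_mul' ((hEZ i).trans (mul_le_mul' le_rfl (hE i))) le_rfl)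
        _ = A * (Z * B) := by rw [mul_assoc, hBB]
  -- The left multipliers of `A * (Z * B)` form a subalgebra, so only generators need checking.
  let S : Subalgebra k (Uq b q) :=
    { carrier := {x | ∀ s ∈ A * (Z * B), x * s ∈ A * (Z * B)}
      mul_mem' := fun {x y} hx hy s hs => by
        rw [mul_assoc]
        exact hx _ (hy _ hs)
      add_mem' := fun {x y} hx hy s hs => by
        rw [add_mul]
        exact add_mem (hx _ hs) (hy _ hs)
      algebraMap_mem' := fun c s hs => by
        rw [← Algebra.smul_def]
        exact Submodule.smul_mem _ _ hs }
  have hSK {g} (hg : g ∈ torus b q) : g ∈ S := fun s hs =>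
    hZS (Submodule.mul_mem_mul (torus_le_Uzero hg) hs)
  have hSF (i) : F b q i ∈ S := by
    have h1 : F b q i = FK b q i * Kinv b q i := by
      rw [FK, mul_assoc, K_mul_Kinv, mul_one]
    rw [h1]
    exact mul_mem (fun s hs => hAS (Submodule.mul_mem_mul (hFK i) hs)) (hSK (Kinv_mem_torus i))
  have hSE (i) : E b q i ∈ S := fun s hs =>
    hES i (Submodule.mul_mem_mul (Submodule.mem_span_singleton_self _) hs)
  have hgen : S.comap (mk b q) = ⊤ := by
    rw [eq_top_iff, ← FreeAlgebra.adjoin_range_ι, Algebra.adjoin_le_iff]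
    rintro _ ⟨x, rfl⟩
    cases x with
    | E i => exact hSE i
    | F i => exact hSF i
    | K i => exact hSK (K_mem_torus i)
    | Kinv i => exact hSK (Kinv_mem_torus i)
  rw [eq_top_iff]
  rintro x -
  obtain ⟨y, rfl⟩ := RingQuot.mkAlgHom_surjective k (Rel b q) x
  have h1 : y ∈ S.comap (mk b q) := hgen ▸ Algebra.mem_top
  have h2 := h1 (1 * (1 * 1)) (Submodule.mul_mem_mul (show (1 : Uq b q) ∈ A from one_mem (UFK b q))
    (Submodule.mul_mem_mul (show (1 : Uq b q) ∈ Z from one_mem (Uzero b q))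
      (show (1 : Uq b q) ∈ B from one_mem (Upos b q))))
  rwa [mul_one, mul_one, mul_one] at h2

end Algebra
-- Decomposition of a right coideal subalgebra
section Algebra
variable {J L M N : Type*} [Fintype J] [Field L] [CharZero L] [AddCommGroup M] [Module L M]
  [AddCommGroup N] [Module L N] {P : RootPairing J L M N} [P.IsCrystallographic]
  {k : Type*} [Field k] {b : P.Base} {q : kˣ}

open Uq

theorem list_prod_mem_adjoin {R I : Type*} [Ring R] [Algebra k R] (X : I → R) (w : List I) :
    (w.map X).prod ∈ Algebra.adjoin k (Set.range X) := by
  rw [← Subalgebra.mem_toSubmodule, adjoin_range_eq_span]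
  exact Submodule.subset_span ⟨w, rfl⟩

theorem list_prod_K_mem_torus (w : List b.support) : (w.map (K b q)).prod ∈ torus b q :=
  Submonoid.list_prod_mem _ fun y hy => by
    obtain ⟨i, -, rfl⟩ := List.mem_map.mp hy
    exact K_mem_torus i

theorem toSubmodule_mul_mul_le {R : Type*} [Ring R] [Algebra k R] {A Z B C : Subalgebra k R}
    (hA : A ≤ C) (hZ : Z ≤ C) (hB : B ≤ C) :
    Subalgebra.toSubmodule A * Subalgebra.toSubmodule Z * Subalgebra.toSubmodule B
      ≤ Subalgebra.toSubmodule C := by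
  refine Submodule.mul_le.mpr fun m hm z hz => C.mul_mem ?_ (hB hz)
  have h : Subalgebra.toSubmodule A * Subalgebra.toSubmodule Z ≤ Subalgebra.toSubmodule C :=
    Submodule.mul_le.mpr fun x hx y hy => C.mul_mem (hA hx) (hZ hy)
  exact h hm

section Surjectivity
variable {g g' : Uq b q} {t : kˣ} {κ κ' : Type*} {a : κ → List b.support}
  {a' : κ' → List b.support}

/-- The monomials `(FK)_v K E_w`, for words `v` and `w`. -/
def monomial (a : κ → List b.support) (a' : κ' → List b.support)
    (p : κ' × (κ × torus b q)) : Uq b q :=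
  ((a p.2.1).map (FK b q)).prod * (p.2.2 : Uq b q) * ((a' p.1).map (E b q)).prod

theorem span_monomial_eq_top
    (ha : Submodule.span k (Set.range fun j => ((a j).map (FK b q)).prod)
      = Subalgebra.toSubmodule (UFK b q))
    (ha' : Submodule.span k (Set.range fun j => ((a' j).map (E b q)).prod)
      = Subalgebra.toSubmodule (Upos b q)) :
    Submodule.span k (Set.range (monomial (q := q) a a')) = ⊤ := by
  rw [eq_top_iff, ← FK_mul_Uzero_mul_E_eq_top, ← ha, ← ha', Uzero_eq_span,
    Submodule.span_mul_span, Submodule.span_mul_span]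
  refine Submodule.span_mono ?_
  rintro _ ⟨_, ⟨j, rfl⟩, _, ⟨h, hh, _, ⟨j', rfl⟩, rfl⟩, rfl⟩
  exact ⟨(j', (j, ⟨h, hh⟩)), mul_assoc _ _ _⟩

theorem conj_monomial (hE : ActsByWeight g t fun _ => 1) (hg : g ∈ torus b q) (h : g * g' = 1)
    (p : κ' × (κ × torus b q)) :
    g * monomial a a' p * g'
      = (t : k) ^ (((a' p.1).length : ℤ) - (a p.2.1).length) • monomial a a' p := by
  have h1 : monomial a a' p
      ∈ weightSpace g t (((a' p.1).length : ℤ) - (a p.2.1).length) := by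
    have h2 := weightSpace_mul (weightSpace_mul (weightSpace_list_prod
      (fun i => FK_mem_weightSpace hE hg i) (a p.2.1)) (n := 0)
      (y := (p.2.2 : Uq b q))
      (by simpa [mem_weightSpace] using (torus_commute hg p.2.2.2).eq))
      (weightSpace_list_prod (fun i => (hE i).1) (a' p.1))
    convert h2 using 1
    · simp [sub_eq_neg_add]
    · rfl
  rw [mem_weightSpace.mp h1, smul_mul_assoc, mul_assoc, h, mul_one]

variable (C : Subalgebra k (Uq b q)) [P.IsReduced]

/-- The rows of the part of highest degree of a homogeneous element of `C` lie in `C`. -/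
theorem sum_E_mem (hC : IsRightCoidealSubalgebra C) (hom : Uzero b q ≤ C)
    (hE : ActsByWeight g t fun _ => 1) (hg : g ∈ torus b q) (hg' : g' ∈ torus b q)
    (h : g * g' = 1) (h' : g' * g = 1) (ht : ∀ n : ℕ, 0 < n → (t : k) ^ n ≠ 1)
    (ha : LinearIndependent k fun j => ((a j).map (FK b q)).prod) [DecidableEq (κ × torus b q)]
    {n : ℕ} {s : Finset (κ' × (κ × torus b q))} {f : κ' × (κ × torus b q) → k}
    (hs : ∀ p ∈ s, (a p.2.1).length ≤ n) (hf : ∑ p ∈ s, f p • monomial a a' p ∈ C)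
    (r : κ × torus b q) :
    ∑ p ∈ s with (a p.2.1).length = n ∧ p.2 = r, f p • ((a' p.1).map (E b q)).prod ∈ C := by
  -- For the inverse `g'` the letters `FK` have weight `1` and the letters `E` weight `-1`, so the
  -- top second factor of a monomial is `(FK)_v h`.
  have hE' := hE.inverse h' h
  have h1 := sum_leadingTerm_mem h' ht (V := Subalgebra.toSubmodule C) (s := s) (f := f)
    (m := monomial a a') (n := fun p => (a p.2.1).length) (d := n)
    (z := fun p => (((a p.2.1).map (K b q)).prod * (p.2.2 : Uq b q) * ((a' p.1).map (E b q)).prod)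
      ⊗ₜ (((a p.2.1).map (FK b q)).prod * (p.2.2 : Uq b q))) hC
    (fun p _ => by
      have := ((skew_hasLeadingTerm_pos comulHom_FK
        (fun i => by simpa using FK_mem_weightSpace hE' hg' i) (a p.2.1)).mul
        (torus_hasLeadingTerm hg' p.2.2.2)).mul
        (skew_hasLeadingTerm_neg (comulHom_E b q) (fun i => (hE' i).1) (a' p.1))
      rwa [← map_mul, ← map_mul, Algebra.TensorProduct.tmul_mul_tmul,
        Algebra.TensorProduct.tmul_mul_tmul, mul_one, add_zero, add_zero] at this)
    (fun p hp => by exact_mod_cast hs p hp) hf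
  simp only [Nat.cast_inj, TensorProduct.smul_tmul'] at h1
  have hLI := linearIndependent_skew_mul_torus hg h ht comulHom_FK
    (fun i => FK_mem_weightSpace hE hg i) ha
  have h2 := sum_filter_mem_of_sum_tmul_mem hLI (π := fun p : κ' × (κ × torus b q) => p.2) h1 r
  rw [Finset.filter_filter] at h2
  -- The coefficients of `(FK)_v h` carry the factor `K_v h`, which depends only on `r = (v, h)` and
  -- is a unit of `C`.
  have hr : ((a r.1).map (K b q)).prod * (r.2 : Uq b q) ∈ torus b q :=
    mul_mem (list_prod_K_mem_torus _) r.2.2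
  refine mem_of_torus_mul_mem hom hr ?_
  rw [Finset.mul_sum]
  rw [Subalgebra.mem_toSubmodule] at h2
  convert h2 using 1
  refine Finset.sum_congr rfl fun p hp => ?_
  rw [mul_smul_comm, (Finset.mem_filter.mp hp).2.2]

/-- The columns of the part of highest degree of a homogeneous element of `C` lie in `C`. -/
theorem sum_FK_mem (hC : IsRightCoidealSubalgebra C) (hom : Uzero b q ≤ C)
    (hE : ActsByWeight g t fun _ => 1) (hg : g ∈ torus b q) (hg' : g' ∈ torus b q)
    (h : g * g' = 1) (h' : g' * g = 1) (ht : ∀ n : ℕ, 0 < n → (t : k) ^ n ≠ 1)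
    (ha' : LinearIndependent k fun j => ((a' j).map (E b q)).prod) [DecidableEq (κ' × torus b q)]
    {n : ℤ} {s : Finset (κ' × (κ × torus b q))} {f : κ' × (κ × torus b q) → k}
    (hs : ∀ p ∈ s, ((a' p.1).length : ℤ) ≤ n) (hf : ∑ p ∈ s, f p • monomial a a' p ∈ C)
    (r : κ' × torus b q) :
    ∑ p ∈ s with ((a' p.1).length : ℤ) = n ∧ (p.1, p.2.2) = r,
      f p • ((a p.2.1).map (FK b q)).prod ∈ C := by
  have hE' := hE.inverse h' h
  have h1 := sum_leadingTerm_mem h ht (V := Subalgebra.toSubmodule C) (s := s) (f := f)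
    (m := monomial a a') (n := fun p => (a' p.1).length) (d := n)
    (z := fun p => (((a p.2.1).map (FK b q)).prod * (p.2.2 : Uq b q) * ((a' p.1).map (K b q)).prod)
      ⊗ₜ ((p.2.2 : Uq b q) * ((a' p.1).map (E b q)).prod)) hC
    (fun p _ => by
      have := ((skew_hasLeadingTerm_neg comulHom_FK
        (fun i => FK_mem_weightSpace hE hg i) (a p.2.1)).mul
        (torus_hasLeadingTerm hg p.2.2.2)).mul
        (skew_hasLeadingTerm_pos (comulHom_E b q) (fun i => (hE i).1) (a' p.1))
      rwa [← map_mul, ← map_mul, Algebra.TensorProduct.tmul_mul_tmul,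
        Algebra.TensorProduct.tmul_mul_tmul, one_mul, zero_add, zero_add] at this)
    hs hf
  simp only [TensorProduct.smul_tmul'] at h1
  have hLI := linearIndependent_torus_mul_skew hg' h' ht (comulHom_E b q)
    (fun i => (hE' i).1) ha'
  have h2 := sum_filter_mem_of_sum_tmul_mem hLI
    (π := fun p : κ' × (κ × torus b q) => (p.1, p.2.2)) h1 r
  rw [Finset.filter_filter] at h2
  -- Again the surplus factor `h K_w` depends only on `r = (w, h)` and can be cancelled inside `C`.
  have hr : (r.2 : Uq b q) * ((a' r.1).map (K b q)).prod ∈ torus b q :=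
    mul_mem r.2.2 (list_prod_K_mem_torus _)
  refine mem_of_mul_torus_mem hom hr ?_
  rw [Finset.sum_mul]
  rw [Subalgebra.mem_toSubmodule] at h2
  convert h2 using 1
  refine Finset.sum_congr rfl fun p hp => ?_
  rw [smul_mul_assoc, ← (Finset.mem_filter.mp hp).2.2, mul_assoc]

/-- Induction on a strict bound for `|v|`. The part with `|v|` maximal lies in the product of
intersections, hence in `C`, so it may be subtracted. -/
theorem sum_monomial_mem_of_homogeneous (hC : IsRightCoidealSubalgebra C) (hom : Uzero b q ≤ C)
    (hE : ActsByWeight g t fun _ => 1) (hg : g ∈ torus b q) (hg' : g' ∈ torus b q)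
    (h : g * g' = 1) (h' : g' * g = 1) (ht : ∀ n : ℕ, 0 < n → (t : k) ^ n ≠ 1)
    (ha : LinearIndependent k fun j => ((a j).map (FK b q)).prod)
    (ha' : LinearIndependent k fun j => ((a' j).map (E b q)).prod) (d : ℤ) (n : ℕ) :
    ∀ (s : Finset (κ' × (κ × torus b q))) (f : κ' × (κ × torus b q) → k),
      (∀ p ∈ s, ((a' p.1).length : ℤ) = (a p.2.1).length + d) → (∀ p ∈ s, (a p.2.1).length < n) →
      ∑ p ∈ s, f p • monomial a a' p ∈ C →
      ∑ p ∈ s, f p • monomial a a' p ∈ Subalgebra.toSubmodule (UFK b q ⊓ C)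
        * Subalgebra.toSubmodule (Uzero b q) * Subalgebra.toSubmodule (Upos b q ⊓ C) := by
  classical
  set D := Subalgebra.toSubmodule (UFK b q ⊓ C) * Subalgebra.toSubmodule (Uzero b q)
    * Subalgebra.toSubmodule (Upos b q ⊓ C) with hD
  have hDC : D ≤ Subalgebra.toSubmodule C := toSubmodule_mul_mul_le inf_le_right hom inf_le_right
  induction n with
  | zero =>
    intro s f _ hs _
    rw [Finset.sum_eq_zero fun p hp => absurd (hs p hp) (by simp)]
    exact Submodule.zero_mem _
  | succ n ih =>
    intro s f hd hs hf
    -- Homogeneity enters here: the terms extremal for `FK` are also those extremal for `E`, so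
    -- `sum_E_mem` and `sum_FK_mem` speak of the same coefficients.
    have hlen {p} (hp : p ∈ s) : (a p.2.1).length = n ↔ ((a' p.1).length : ℤ) = n + d := by
      have := hd p hp
      constructor <;> lia
    have htop : ∑ p ∈ s with (a p.2.1).length = n, f p • monomial a a' p ∈ D := by
      rw [← Finset.sum_fiberwise_of_maps_to (g := fun p : κ' × (κ × torus b q) => p.2.2)
        fun p hp => Finset.mem_image_of_mem (fun p : κ' × (κ × torus b q) => p.2.2) hp]
      refine Submodule.sum_mem _ fun r _ => ?_
      -- For a fixed torus element `r` the monomials are values of the bilinear map `(x, y) ↦ x r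
      -- y`.
      let B : Uq b q →ₗ[k] Uq b q →ₗ[k] Uq b q :=
        LinearMap.mul k (Uq b q) ∘ₗ LinearMap.mulRight k (r : Uq b q)
      have h1 := sum_bilin_mem B (M := Subalgebra.toSubmodule (UFK b q ⊓ C))
        (P := Subalgebra.toSubmodule (Upos b q ⊓ C)) (q := D)
        (fun x hx y hy => Submodule.mul_mem_mul
          (Submodule.mul_mem_mul hx (torus_le_Uzero r.2)) hy)
        ((s.filter fun p => (a p.2.1).length = n).filter fun p => p.2.2 = r)
        (fun p => p.2.1) (fun p => p.1) f (fun j => ((a j).map (FK b q)).prod)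
        (fun j => ((a' j).map (E b q)).prod) (fun j => ⟨?_, ?_⟩) (fun j => ⟨?_, ?_⟩)
      · convert h1 using 1
        refine Finset.sum_congr rfl fun p hp => ?_
        rw [monomial, (Finset.mem_filter.mp hp).2]
        rfl
      · exact sum_mem fun p _ => Subalgebra.smul_mem _ (list_prod_mem_adjoin _ _) _
      · have h2 := sum_E_mem C hC hom hE hg hg' h h' ht ha (n := n)
          (fun p hp => Nat.lt_succ_iff.mp (hs p hp)) hf (j, r)
        change _ ∈ C
        convert h2 using 2
        ext p
        simp only [Finset.mem_filter, Prod.ext_iff]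
        tauto
      · exact sum_mem fun p _ => Subalgebra.smul_mem _ (list_prod_mem_adjoin _ _) _
      · have h2 := sum_FK_mem C hC hom hE hg hg' h h' ht ha' (n := n + d)
          (fun p hp => by
            have := hd p hp
            have := hs p hp
            lia) hf (j, r)
        change _ ∈ C
        convert h2 using 2
        ext p
        simp only [Finset.mem_filter, Prod.ext_iff]
        constructor
        · rintro ⟨⟨⟨h1, h2⟩, h3⟩, h4⟩
          exact ⟨h1, (hlen h1).mp h2, h4, h3⟩
        · rintro ⟨h1, h2, h3, h4⟩
          exact ⟨⟨⟨h1, (hlen h1).mpr h2⟩, h4⟩, h3⟩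
    have hsplit := Finset.sum_filter_add_sum_filter_not s (fun p => (a p.2.1).length = n)
      fun p => f p • monomial a a' p
    rw [← hsplit]
    refine add_mem htop (ih _ f (fun p hp => hd p (Finset.mem_of_mem_filter p hp))
      (fun p hp => ?_) ?_)
    · rw [Finset.mem_filter] at hp
      have := hs p hp.1
      lia
    · rw [eq_sub_of_add_eq' hsplit]
      exact sub_mem hf (hDC htop)

/-- Monomials are eigenvectors for conjugation by the height element, which preserves `C`; each
eigencomponent therefore lies in `C` and is homogeneous. -/
theorem le_FK_mul_Uzero_mul_E (hq : ∀ n : ℕ, 0 < n → (q : k) ^ n ≠ 1)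
    (hC : IsRightCoidealSubalgebra C) (hom : Uzero b q ≤ C) :
    Subalgebra.toSubmodule C ≤ Subalgebra.toSubmodule (UFK b q ⊓ C)
        * Subalgebra.toSubmodule (Uzero b q) * Subalgebra.toSubmodule (Upos b q ⊓ C) := by
  classical
  obtain ⟨t, ht, g, hg, hE⟩ := exists_height_element (b := b) hq
  obtain ⟨g', hg', h, h'⟩ := exists_inverse_mem_torus hg
  obtain ⟨κ, a, ha, has⟩ := exists_word_basis (k := k) (FK b q)
  obtain ⟨κ', a', ha', has'⟩ := exists_word_basis (k := k) (E b q)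
  intro c hc
  have hspan : c ∈ Submodule.span k (Set.range (monomial (q := q) a a')) := by
    rw [span_monomial_eq_top has has']
    exact Submodule.mem_top
  obtain ⟨f, rfl⟩ := Finsupp.mem_span_range_iff_exists_finsupp.mp hspan
  rw [Finsupp.sum] at hc ⊢
  let w (p : κ' × (κ × torus b q)) : k := (t : k) ^ (((a' p.1).length : ℤ) - (a p.2.1).length)
  rw [← Finset.sum_fiberwise_of_maps_to (g := w) fun p hp => Finset.mem_image_of_mem _ hp]
  refine Submodule.sum_mem _ fun γ hγ => ?_
  obtain ⟨p₀, -, rfl⟩ := Finset.mem_image.mp hγ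
  have hw {p} (hp : w p = w p₀) : ((a' p.1).length : ℤ) - (a p.2.1).length
      = (a' p₀.1).length - (a p₀.2.1).length :=
    zpow_injective_of_pow_ne_one ht hp
  have h1 : ∑ p ∈ f.support with w p = w p₀, f p • monomial a a' p ∈ Subalgebra.toSubmodule C := by
    refine sum_filter_eigenvectors_mem
      (LinearMap.mulRight k g' ∘ₗ LinearMap.mulLeft k g) ?_ (w p₀) f.support
      (fun p => f p • monomial a a' p) w (fun p _ => ?_) hc
    · intro x hx
      exact C.mul_mem (C.mul_mem (hom (torus_le_Uzero hg)) hx) (hom (torus_le_Uzero hg'))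
    · rw [map_smul, smul_comm]
      congr 1
      exact conj_monomial hE hg h p
  refine sum_monomial_mem_of_homogeneous C hC hom hE hg hg' h h' ht ha ha'
    ((a' p₀.1).length - (a p₀.2.1).length)
    ((f.support.sup fun p => (a p.2.1).length) + 1) _ f (fun p hp => ?_) (fun p hp => ?_) h1
  · have := hw (Finset.mem_filter.mp hp).2
    lia
  · exact Nat.lt_succ_of_le
      (Finset.le_sup (f := fun p => (a p.2.1).length) (Finset.mem_of_mem_filter p hp))

end Surjectivity
end Algebra
-- The multiplication map on a triple tensor product
section MulMap
variable {k R A Z B : Type*} [Field k] [Ring R] [Algebra k R] [AddCommGroup A] [Module k A]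
  [AddCommGroup Z] [Module k Z] [AddCommGroup B] [Module k B]

/-- The map `x ⊗ y ⊗ z ↦ x y z`, for `x`, `y`, `z` in spaces mapping to an algebra. -/
def mulMap (f : A →ₗ[k] R) (g : Z →ₗ[k] R) (h : B →ₗ[k] R) : A ⊗[k] Z ⊗[k] B →ₗ[k] R :=
  LinearMap.mul' k R ∘ₗ
    TensorProduct.map (LinearMap.mul' k R ∘ₗ TensorProduct.map f g) h

theorem mulMap_tmul (f : A →ₗ[k] R) (g : Z →ₗ[k] R) (h : B →ₗ[k] R) (x : A) (y : Z) (z : B) :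
    mulMap f g h (x ⊗ₜ y ⊗ₜ z) = f x * g y * h z := rfl

theorem mulMap_injective {ι κ ν : Type*} {f : A →ₗ[k] R} {g : Z →ₗ[k] R} {h : B →ₗ[k] R}
    (e₁ : Module.Basis ι k A) (e₂ : Module.Basis κ k Z) (e₃ : Module.Basis ν k B)
    (hLI : LinearIndependent k fun p : (ι × κ) × ν => f (e₁ p.1.1) * g (e₂ p.1.2) * h (e₃ p.2)) :
    Function.Injective (mulMap f g h) := by
  let e := (e₁.tensorProduct e₂).tensorProduct e₃
  have he : (fun p : (ι × κ) × ν => f (e₁ p.1.1) * g (e₂ p.1.2) * h (e₃ p.2))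
      = fun p => mulMap f g h (e p) := by
    funext p
    rw [Module.Basis.tensorProduct_apply, Module.Basis.tensorProduct_apply, mulMap_tmul]
  rw [he] at hLI
  intro x y hxy
  apply e.repr.injective
  apply hLI
  have key (x) : Finsupp.linearCombination k (fun p => mulMap f g h (e p)) (e.repr x)
      = mulMap f g h x := by
    conv_rhs => rw [← e.linearCombination_repr x]
    rw [Finsupp.apply_linearCombination]
    rfl
  rw [key, key, hxy]

theorem exists_basis_of_span_eq {ι : Type*} {S : Subalgebra k R} {v : ι → R}
    (hv : LinearIndependent k v)
    (h : Submodule.span k (Set.range v) = Subalgebra.toSubmodule S) :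
    ∃ e : Module.Basis ι k S, ∀ i, (e i : R) = v i := by
  refine ⟨(Module.Basis.span hv).map
    ((LinearEquiv.ofEq _ _ h).trans (Subalgebra.toSubmoduleEquiv S)), fun i => ?_⟩
  rw [Module.Basis.map_apply]
  exact congrArg Subtype.val (Module.Basis.span_apply hv i)

theorem range_mulMap (f : A →ₗ[k] R) (g : Z →ₗ[k] R) (h : B →ₗ[k] R) :
    LinearMap.range (mulMap f g h)
      = LinearMap.range f * LinearMap.range g * LinearMap.range h := by
  apply le_antisymm
  · rintro _ ⟨u, rfl⟩
    induction u with
    | zero => simp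
    | add u v hu hv => rw [map_add]; exact add_mem hu hv
    | tmul u z =>
      induction u with
      | zero => simp
      | add u v hu hv => rw [TensorProduct.add_tmul, map_add]; exact add_mem hu hv
      | tmul x y => exact Submodule.mul_mem_mul (Submodule.mul_mem_mul ⟨x, rfl⟩ ⟨y, rfl⟩) ⟨z, rfl⟩
  · refine Submodule.mul_le.mpr fun m hm z hz => ?_
    obtain ⟨z, rfl⟩ := hz
    induction hm using Submodule.mul_induction_on' with
    | mem_mul_mem x hx y hy =>
      obtain ⟨x, rfl⟩ := hx
      obtain ⟨y, rfl⟩ := hy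
      exact ⟨x ⊗ₜ y ⊗ₜ z, rfl⟩
    | add x _ y _ hx hy => rw [add_mul]; exact add_mem hx hy

theorem range_val_toLinearMap (S : Subalgebra k R) :
    LinearMap.range S.val.toLinearMap = Subalgebra.toSubmodule S :=
  Submodule.range_subtype (Subalgebra.toSubmodule S)

end MulMap

/-! ### Passage from `F_α K_α` to `F_α`, and the isomorphism -/

section Algebra
variable {J L M N : Type*} [Fintype J] [Field L] [CharZero L] [AddCommGroup M] [Module L M]
  [AddCommGroup N] [Module L N] {P : RootPairing J L M N} [P.IsCrystallographic]
  {k : Type*} [Field k] {b : P.Base} {q : kˣ}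

open Uq

/-- Collecting the `K_α` on the right of the `F_β` costs only a power of `q`. -/
theorem exists_list_prod_FK_eq (w : List b.support) :
    ∃ c : k, (w.map (FK b q)).prod = c • ((w.map (F b q)).prod * (w.map (K b q)).prod) := by
  induction w with
  | nil => exact ⟨1, by simp⟩
  | cons i w ih =>
    obtain ⟨c, hc⟩ := ih
    obtain ⟨d, hd⟩ := mul_list_prod_scale (torus_mul_F (K_mem_torus (q := q) i)) w
    refine ⟨c * d, ?_⟩
    simp only [List.map_cons, List.prod_cons]
    rw [hc, FK, mul_smul_comm, mul_assoc, ← mul_assoc (K b q i), hd, smul_mul_assoc,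
      mul_smul_comm, smul_smul]
    simp only [mul_assoc]

variable [P.IsReduced] (C : Subalgebra k (Uq b q))

/-- Partial sums over all words with the same letters are obtained by conjugating with the `K_α`. -/
theorem sum_filter_multiset_mem (hq : ∀ n : ℕ, 0 < n → (q : k) ^ n ≠ 1) (hom : Uzero b q ≤ C)
    {s : Finset (List b.support)} {f : List b.support → k}
    [DecidableEq (Multiset b.support)]
    (hf : ∑ w ∈ s, f w • (w.map (FK b q)).prod ∈ C) (w₀ : List b.support) :
    ∑ w ∈ s with Multiset.ofList w = Multiset.ofList w₀, f w • (w.map (FK b q)).prod ∈ C := by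
  classical
  let χ (i : b.support) (w : List b.support) : ℤ :=
    (w.map fun j : b.support => -normForm P i j).sum
  -- One simple root at a time: conjugation by `K_j` isolates the words with a prescribed `j`-th
  -- weight among those already selected.
  have hχ (T : Finset b.support) :
      ∑ w ∈ s with ∀ i ∈ T, χ i w = χ i w₀, f w • (w.map (FK b q)).prod ∈ C := by
    induction T using Finset.induction_on with
    | empty => simpa using hf
    | insert j T _ ih =>
      have h1 := sum_filter_eigenvectors_mem
        (LinearMap.mulRight k (Kinv b q j) ∘ₗ LinearMap.mulLeft k (K b q j))
        (p := Subalgebra.toSubmodule C)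
        (fun x hx => C.mul_mem (C.mul_mem (hom (torus_le_Uzero (K_mem_torus j))) hx)
          (hom (torus_le_Uzero (Kinv_mem_torus j)))) ((q : k) ^ χ j w₀) _ _
        (fun w => (q : k) ^ χ j w) (fun w _ => ?_) ih
      · rw [Finset.filter_filter] at h1
        have e : {w ∈ s | ∀ i ∈ insert j T, χ i w = χ i w₀}
            = {w ∈ s | (∀ i ∈ T, χ i w = χ i w₀) ∧ (q : k) ^ χ j w = (q : k) ^ χ j w₀} := by
          refine Finset.filter_congr fun w _ => ?_
          rw [Finset.forall_mem_insert, and_comm, (zpow_injective_of_pow_ne_one hq).eq_iff]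
        rw [e]
        exact h1
      · rw [map_smul, smul_comm]
        congr 1
        have h2 : (w.map (FK b q)).prod ∈ weightSpace (K b q j) q (χ j w) :=
          weightSpace_list_prod
            (fun i => FK_mem_weightSpace (K_actsByWeight j) (K_mem_torus j) i) w
        simp only [LinearMap.comp_apply, LinearMap.mulLeft_apply, LinearMap.mulRight_apply]
        rw [mem_weightSpace.mp h2, smul_mul_assoc, mul_assoc, K_mul_Kinv, mul_one]
  -- Nondegeneracy of the form: agreement of all the weights means that the words have the same
  -- letters.
  convert hχ Finset.univ using 3 with w
  rw [Multiset.coe_eq_coe]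
  constructor
  · exact fun h i _ => (h.map _).sum_eq
  · intro h
    refine perm_of_sum_normForm_eq fun i => ?_
    have h1 := h i (Finset.mem_univ i)
    have h2 (w : List b.support) : χ i w = -(w.map fun j : b.support => normForm P i j).sum := by
      induction w with
      | nil => simp [χ]
      | cons l w ih =>
        simp only [χ, List.map_cons, List.sum_cons] at ih ⊢
        rw [ih]
        ring
    rwa [h2, h2, neg_inj] at h1

/-- Words with the same letters have the same product of `K_α`. So each weight component in `C` is a
combination of words `F_v` times one common torus element, which is a unit of `C`. -/
theorem UFK_inf_le (hq : ∀ n : ℕ, 0 < n → (q : k) ^ n ≠ 1) (hom : Uzero b q ≤ C) :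
    Subalgebra.toSubmodule (UFK b q ⊓ C)
      ≤ Subalgebra.toSubmodule (Uneg b q ⊓ C) * Subalgebra.toSubmodule (Uzero b q) := by
  classical
  rintro y ⟨hy, hyC⟩
  have hy' : y ∈ Subalgebra.toSubmodule (UFK b q) := hy
  rw [UFK, adjoin_range_eq_span] at hy'
  obtain ⟨f, rfl⟩ := Finsupp.mem_span_range_iff_exists_finsupp.mp hy'
  rw [Finsupp.sum] at hyC ⊢
  rw [← Finset.sum_fiberwise_of_maps_to
    (g := fun w : List b.support => (w : Multiset b.support))
    fun w hw => Finset.mem_image_of_mem _ hw]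
  refine Submodule.sum_mem _ fun m hm => ?_
  obtain ⟨w₀, -, rfl⟩ := Finset.mem_image.mp hm
  have h1 := sum_filter_multiset_mem C hq hom hyC w₀
  choose c hc using exists_list_prod_FK_eq (b := b) (q := q)
  have h2 : ∑ w ∈ f.support with Multiset.ofList w = Multiset.ofList w₀, f w • (w.map (FK b q)).prod
      = (∑ w ∈ f.support with Multiset.ofList w = Multiset.ofList w₀,
          (f w * c w) • (w.map (F b q)).prod)
        * (w₀.map (K b q)).prod := by
    rw [Finset.sum_mul]
    refine Finset.sum_congr rfl fun w hw => ?_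
    have hperm := Multiset.coe_eq_coe.mp (Finset.mem_filter.mp hw).2
    have hK : (w.map (K b q)).prod = (w₀.map (K b q)).prod := by
      refine (hperm.map _).prod_eq' ?_
      rw [List.pairwise_map]
      exact List.pairwise_of_forall fun i j => K_mul_K b q i j
    rw [hc, hK, smul_smul, smul_mul_assoc]
  rw [h2] at h1 ⊢
  refine Submodule.mul_mem_mul ⟨?_, mem_of_mul_torus_mem hom (list_prod_K_mem_torus _) h1⟩
    (torus_le_Uzero (list_prod_K_mem_torus _))
  exact sum_mem fun w _ => Subalgebra.smul_mem _ (list_prod_mem_adjoin _ _) _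

theorem le_Uneg_mul_Uzero_mul_Upos (hq : ∀ n : ℕ, 0 < n → (q : k) ^ n ≠ 1)
    (hC : IsRightCoidealSubalgebra C) (hom : Uzero b q ≤ C) :
    Subalgebra.toSubmodule C ≤ Subalgebra.toSubmodule (Uneg b q ⊓ C)
        * Subalgebra.toSubmodule (Uzero b q) * Subalgebra.toSubmodule (Upos b q ⊓ C) := by
  refine (le_FK_mul_Uzero_mul_E C hq hC hom).trans (mul_le_mul' ?_ le_rfl)
  refine (mul_le_mul' (UFK_inf_le C hq hom) le_rfl).trans ?_
  rw [mul_assoc, (Subalgebra.isIdempotentElem_toSubmodule _).eq]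

/-- The products of basis elements are the independent elements `F_v h E_w`, for word bases of `U⁻`
and `U⁺` and the basis of `U⁰` given by torus monomials. -/
theorem mulMap_Uneg_Uzero_Upos_injective (hq : ∀ n : ℕ, 0 < n → (q : k) ^ n ≠ 1) :
    Function.Injective (mulMap (Uneg b q).val.toLinearMap (Uzero b q).val.toLinearMap
      (Upos b q).val.toLinearMap) := by
  obtain ⟨t, ht, g, hg, hE⟩ := exists_height_element (b := b) hq
  obtain ⟨g', hg', h, h'⟩ := exists_inverse_mem_torus hg
  obtain ⟨κ, a, ha, has⟩ := exists_word_basis (k := k) (F b q)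
  obtain ⟨κ', a', ha', has'⟩ := exists_word_basis (k := k) (E b q)
  obtain ⟨e₁, he₁⟩ := exists_basis_of_span_eq (S := Uneg b q) ha has
  obtain ⟨e₂, he₂⟩ := exists_basis_of_span_eq (S := Uzero b q) (linearIndependent_torus (q := q))
    (by rw [Uzero_eq_span, Subtype.range_coe_subtype]; rfl)
  obtain ⟨e₃, he₃⟩ := exists_basis_of_span_eq (S := Upos b q) ha' has'
  refine mulMap_injective e₁ e₂ e₃ ?_
  have hE' := hE.inverse h' h
  have hLI := linearIndependent_F_mul_torus_mul_E hg' h' ht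
    (fun i => by simpa using (hE' i).2) (fun i => (hE' i).1) ha ha'
  -- The independent family is indexed with the `E`-word first, the tensor basis with it last.
  have := hLI.comp Prod.swap Prod.swap_injective
  convert this using 1
  funext p
  simp [he₁, he₂, he₃]

/-- Over a field the inclusions of the intersections stay injective after tensoring, so injectivity
is inherited from the multiplication map on all of `U`. Only the description of the image uses that
`C` is a right coideal. -/
theorem exists_triangular_decomposition (hq : ∀ n : ℕ, 0 < n → (q : k) ^ n ≠ 1)
    (hC : IsRightCoidealSubalgebra C) (hom : Uzero b q ≤ C) :
    ∃ φ : (↥(Uneg b q ⊓ C) ⊗[k] ↥(Uzero b q) ⊗[k] ↥(Upos b q ⊓ C)) ≃ₗ[k] ↥C,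
      ∀ (x : ↥(Uneg b q ⊓ C)) (y : ↥(Uzero b q)) (z : ↥(Upos b q ⊓ C)),
        (φ (x ⊗ₜ[k] y ⊗ₜ[k] z) : Uq b q) = (x : Uq b q) * y * z := by
  let f := mulMap (Uneg b q ⊓ C).val.toLinearMap (Uzero b q).val.toLinearMap
    (Upos b q ⊓ C).val.toLinearMap
  have hinj : Function.Injective f := by
    have h1 : f = mulMap (Uneg b q).val.toLinearMap (Uzero b q).val.toLinearMap
        (Upos b q).val.toLinearMap ∘ₗ TensorProduct.map (TensorProduct.map
          (Subalgebra.inclusion (inf_le_left : Uneg b q ⊓ C ≤ _)).toLinearMap LinearMap.id)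
          (Subalgebra.inclusion (inf_le_left : Upos b q ⊓ C ≤ _)).toLinearMap :=
      TensorProduct.ext_threefold fun x y z => rfl
    rw [h1, LinearMap.coe_comp]
    refine (mulMap_Uneg_Uzero_Upos_injective hq).comp ?_
    exact TensorProduct.map_injective_of_flat_flat _ _
      (TensorProduct.map_injective_of_flat_flat _ _ (Subalgebra.inclusion_injective inf_le_left)
        Function.injective_id) (Subalgebra.inclusion_injective inf_le_left)
  have hrange : LinearMap.range f = Subalgebra.toSubmodule (Uneg b q ⊓ C)
      * Subalgebra.toSubmodule (Uzero b q) * Subalgebra.toSubmodule (Upos b q ⊓ C) := by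
    rw [range_mulMap, range_val_toLinearMap, range_val_toLinearMap, range_val_toLinearMap]
  have hmem (u) : f u ∈ Subalgebra.toSubmodule C := by
    have h1 : f u ∈ LinearMap.range f := ⟨u, rfl⟩
    rw [hrange] at h1
    exact toSubmodule_mul_mul_le inf_le_right hom inf_le_right h1
  have hsurj : Subalgebra.toSubmodule C ≤ LinearMap.range f := by
    rw [hrange]
    exact le_Uneg_mul_Uzero_mul_Upos C hq hC hom
  let ψ := LinearEquiv.ofBijective (f.codRestrict (Subalgebra.toSubmodule C) hmem)
    ⟨fun u v huv => hinj (congrArg Subtype.val huv), fun c => by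
      obtain ⟨u, hu⟩ := hsurj c.2
      exact ⟨u, Subtype.ext hu⟩⟩
  exact ⟨ψ.trans (Subalgebra.toSubmoduleEquiv C), fun x y z => rfl⟩

end Algebra
end QuantizedEnveloping

/-! ### The root system of a semisimple Lie algebra -/

theorem mainTheorem5
    {𝔤 : Type*} [LieRing 𝔤] [LieAlgebra ℂ 𝔤] [FiniteDimensional ℂ 𝔤] [LieAlgebra.IsSemisimple ℂ 𝔤]
    (H : LieSubalgebra ℂ 𝔤) [H.IsCartanSubalgebra]
    (b : (LieAlgebra.IsKilling.rootSystem H).Base)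
    {k : Type*} [Field k] (q : kˣ) (hq : ∀ n : ℕ, 0 < n → (q : k) ^ n ≠ 1)
    (C : Subalgebra k (QuantizedEnveloping.Uq b q))
    (hC : QuantizedEnveloping.IsRightCoidealSubalgebra C)
    (hom : QuantizedEnveloping.Uzero b q ≤ C) :
    ∃ φ : (↥(QuantizedEnveloping.Uneg b q ⊓ C) ⊗[k] ↥(QuantizedEnveloping.Uzero b q)
        ⊗[k] ↥(QuantizedEnveloping.Upos b q ⊓ C)) ≃ₗ[k] ↥C,
      ∀ (x : ↥(QuantizedEnveloping.Uneg b q ⊓ C)) (y : ↥(QuantizedEnveloping.Uzero b q))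
        (z : ↥(QuantizedEnveloping.Upos b q ⊓ C)),
        (φ (x ⊗ₜ[k] y ⊗ₜ[k] z) : QuantizedEnveloping.Uq b q)
          = (x : QuantizedEnveloping.Uq b q) * y * z :=
  QuantizedEnveloping.exists_triangular_decomposition C hq hC hom
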